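/- **Setting.** A single item is offered to $m \ge 1$ bidders whose types are drawn i.i.d. from a probability distribution $\mu$ on a finite set $T$ of $c$ types. A mechanism assigns to each reported type profile $t \in T^m$ probabilities $\varphi_1(t),\dots,\varphi_m(t)\ge 0$ with $\sum_i \varphi_i(t)\le 1$, where $\varphi_i(t)$ is the probability that bidder $i$ receives the item; let $M_i(A)$ be the probability that bidder $i$ receives the item when she reports $A \in T$ and the other bidders' types are drawn independently from $\mu$ and reported truthfully. A bidder-symmetric reduced form is a vector $\pi \in [0,1]^T$; a mechanism implements it if $M_i(A) \ge \pi(A)$ for all $i$ and $A$, and implements it exactly if $M_i(A) = \pi(A)$ for all $i$ and $A$. A reduced form is feasible if some mechanism implements it. A hierarchical mechanism is given by a function $H : T \to \{1,\dots,c\} \cup \{\mathrm{LOSE}\}$, where $\mathrm{LOSE}$ counts as larger than $c$: on a profile $t$ the item is given uniformly at random to a bidder of the set $\operatorname{argmin}_i H(t_i)$, or is thrown away if $H(t_i) = \mathrm{LOSE}$ for all $i$. Running times are counted on a real random access machine, in which every arithmetic operation on and comparison of real numbers, and every addition, subtraction and comparison of integers, takes one unit of time. **Theorem.** 1. There is an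 algorithm that, given $c$, $m$, $\mu$ and a bidder-symmetric reduced form $\pi$, determines in time $O(c\,(\log c + m))$ whether $\pi$ is feasible and, if it is not, outputs a hyperplane separating $\pi$ from the set of feasible bidder-symmetric reduced forms, that is, $w \in \mathbb{R}^T$ and $b \in \mathbb{R}$ with $\sum_A w_A \pi(A) > b$ and $\sum_A w_A \rho(A) \le b$ for every feasible bidder-symmetric reduced form $\rho$. 2. There is an algorithm that, given $c$, $m$, $\mu$ and a feasible bidder-symmetric reduced form $\pi$, outputs in time polynomial in $c \cdot m$ a succinct description of a mechanism that exactly implements $\pi$. The description consists of at most $c+1$ probabilities $p_1,\dots,p_K$ with $\sum_k p_k = 1$ and an equal number of orderings of $T$ (with equalities allowed, and with a possibly empty class of losing types), given as functions $H_1,\dots,H_K : T \to \{1,\dots,c\}\cup\{\mathrm{LOSE}\}$; the described mechanism runs the hierarchical mechanism $H_k$ with probability $p_k$. 3. A described mechanism runs as follows. There is an algorithm that, given $c$, $m$, such a description, the reported type profile $t$ and a uniformly random real number $u \in [0,1]$, computes in time polynomial in $c \cdot m$ a subset $W$ of the bidders, such that for every set $S$ of bidders the probability (over $u$) that $W = S$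 is $\sum p_k$, over the $k$ for which $S$ is the set of bidders among whom $H_k$ gives the item away on $t$ ($\operatorname{argmin}_i H_k(t_i)$, or $\emptyset$ if all bidders lose). The item is then given uniformly at random to a bidder of $W$, or thrown away if $W = \emptyset$. -/

import Mathlib

open Finset

/-! ## Single-item auctions with `m` bidders whose types are i.i.d. over a finite set -/

namespace Auction

variable {T : Type*} [Fintype T] [DecidableEq T] {m : ℕ}

/-- A probability distribution on the finite type set `T`. -/
def IsDistribution (μ : T → ℝ) : Prop :=
  (∀ A, 0 ≤ μ A) ∧ ∑ A, μ A = 1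

/-- A (randomized) single-item mechanism: `φ t i` is the probability, over the internal randomness,
that bidder `i` gets the item on the reported profile `t`.  It never over-allocates the item. -/
structure Mechanism (m : ℕ) (T : Type*) where
  alloc : (Fin m → T) → Fin m → ℝ
  nonneg : ∀ t i, 0 ≤ alloc t i
  sum_le_one : ∀ t, ∑ i, alloc t i ≤ 1

/-- Probability that bidder `i` gets the item when she reports `A`, the other bidders' types being
drawn independently from `μ` and reported truthfully: the sum over the profiles `t` with `t i = A`
of the probability of `(t j)_{j ≠ i}` times the probability of winning. -/
noncomputable def interim (μ : T → ℝ) (φ : (Fin m → T) → Fin m → ℝ) (i : Fin m) (A : T) : ℝ :=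
  ∑ t : Fin m → T, if t i = A then (∏ j ∈ univ.erase i, μ (t j)) * φ t i else 0

/-- A bidder-symmetric reduced form is a vector in `[0,1]^T`. -/
def IsReducedForm (π : T → ℝ) : Prop :=
  ∀ A, 0 ≤ π A ∧ π A ≤ 1

/-- The mechanism implements the bidder-symmetric reduced form `π`. -/
def Implements (μ : T → ℝ) (M : Mechanism m T) (π : T → ℝ) : Prop :=
  ∀ i A, π A ≤ interim μ M.alloc i A

/-- The mechanism exactly implements the bidder-symmetric reduced form `π`. -/
def ExactlyImplements (μ : T → ℝ) (M : Mechanism m T) (π : T → ℝ) : Prop :=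
  ∀ i A, interim μ M.alloc i A = π A

/-- The set of feasible bidder-symmetric reduced forms for `m` bidders with types i.i.d. from `μ`. -/
def feasibleForms (m : ℕ) (μ : T → ℝ) : Set (T → ℝ) :=
  {π | IsReducedForm π ∧ ∃ M : Mechanism m T, Implements μ M π}

/-- The hyperplane `∑ w_A x_A = b` separates the point `π` from the set `F`. -/
def Separates (w : T → ℝ) (b : ℝ) (π : T → ℝ) (F : Set (T → ℝ)) : Prop :=
  b < ∑ A, w A * π A ∧ ∀ ρ ∈ F, ∑ A, w A * ρ A ≤ b

/-- Giving the item uniformly at random to a bidder of `W`, or throwing it away if `W` is empty: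
the probability that `i` gets it. -/
noncomputable def share (W : Finset (Fin m)) (i : Fin m) : ℝ :=
  if i ∈ W then 1 / (W.card : ℝ) else 0

/-- Levels of a hierarchy on a set of `c` types: smaller levels have higher priority and `⊤` is
`LOSE`. -/
abbrev Level (c : ℕ) := WithTop (Fin c)

/-- The bidders among whom the hierarchical mechanism with levels `H` gives away the item on the
reported profile `t`: those at the smallest level present, unless everybody loses. -/
def winners {c : ℕ} (H : Fin c → Level c) (t : Fin m → Fin c) : Finset (Fin m) :=
  {i | H (t i) ≠ ⊤ ∧ ∀ j, H (t i) ≤ H (t j)}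

/-- The succinct description of a mechanism: at most `c + 1` probabilities and as many hierarchies
(total orderings with equalities, with a possibly empty losing class) of the `c` types. -/
structure Description (c : ℕ) where
  size : ℕ
  size_le : size ≤ c + 1
  prob : Fin size → ℝ
  prob_nonneg : ∀ k, 0 ≤ prob k
  prob_sum : ∑ k, prob k = 1
  level : Fin size → Fin c → Level c

theorem share_nonneg (W : Finset (Fin m)) (i : Fin m) : 0 ≤ share W i := by
  unfold share; split_ifs <;> positivity

theorem sum_share_le_one (W : Finset (Fin m)) : ∑ i, share W i ≤ 1 := by
  simp only [share, Finset.sum_ite_mem, Finset.univ_inter, Finset.sum_const, nsmul_eq_mul]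
  rw [mul_one_div]
  exact div_self_le_one _

/-- The described mechanism: hierarchy `k` is drawn with probability `prob k`, and the hierarchical
mechanism of `k` is run. -/
noncomputable def Description.mechanism {c : ℕ} (D : Description c) (m : ℕ) :
    Mechanism m (Fin c) where
  alloc t i := ∑ k, D.prob k * share (winners (D.level k) t) i
  nonneg t i := Finset.sum_nonneg fun k _ => mul_nonneg (D.prob_nonneg k) (share_nonneg _ _)
  sum_le_one t := by
    rw [Finset.sum_comm, ← D.prob_sum]
    refine Finset.sum_le_sum fun k _ => ?_
    rw [← Finset.mul_sum]
    exact mul_le_of_le_one_right (D.prob_nonneg k) (sum_share_le_one _)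

end Auction

/-! ## A real random access machine

Programs work on finitely many integer registers, real registers, integer arrays and real arrays.
Integers (used for indices and counters) can be added, subtracted (with truncation at `0`) and
compared; reals can be added, subtracted, multiplied, divided and compared.  Every such operation,
every memory access, assignment and test costs one unit of time. -/

namespace RealRAM

/-- The memory.  Arrays are named by natural numbers; a program mentions finitely many of them. -/
structure Store where
  ireg : ℕ → ℕ
  rreg : ℕ → ℝ
  iarr : ℕ → ℕ → ℕ
  rarr : ℕ → ℕ → ℝ

/-- Integer expressions. -/
inductive IExp where
  | lit (n : ℕ)
  | reg (x : ℕ)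
  | get (a : ℕ) (e : IExp)
  | add (e f : IExp)
  | sub (e f : IExp)

/-- Real expressions. -/
inductive RExp where
  | ofInt (e : IExp)
  | reg (x : ℕ)
  | get (a : ℕ) (e : IExp)
  | add (e f : RExp)
  | sub (e f : RExp)
  | mul (e f : RExp)
  | div (e f : RExp)

/-- Tests. -/
inductive Test where
  | ile (e f : IExp)
  | rle (e f : RExp)
  | neg (b : Test)
  | conj (b d : Test)

def IExp.eval (s : Store) : IExp → ℕ
  | .lit n => n
  | .reg x => s.ireg x
  | .get a e => s.iarr a (e.eval s)
  | .add e f => e.eval s + f.eval s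
  | .sub e f => e.eval s - f.eval s

/-- Division by `0` returns `0`. -/
noncomputable def RExp.eval (s : Store) : RExp → ℝ
  | .ofInt e => (e.eval s : ℝ)
  | .reg x => s.rreg x
  | .get a e => s.rarr a (e.eval s)
  | .add e f => e.eval s + f.eval s
  | .sub e f => e.eval s - f.eval s
  | .mul e f => e.eval s * f.eval s
  | .div e f => e.eval s / f.eval s

def Test.Holds (s : Store) : Test → Prop
  | .ile e f => e.eval s ≤ f.eval s
  | .rle e f => e.eval s ≤ f.eval s
  | .neg b => ¬ b.Holds s
  | .conj b d => b.Holds s ∧ d.Holds s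

def IExp.cost : IExp → ℕ
  | .lit _ => 1
  | .reg _ => 1
  | .get _ e => e.cost + 1
  | .add e f => e.cost + f.cost + 1
  | .sub e f => e.cost + f.cost + 1

def RExp.cost : RExp → ℕ
  | .ofInt e => e.cost + 1
  | .reg _ => 1
  | .get _ e => e.cost + 1
  | .add e f => e.cost + f.cost + 1
  | .sub e f => e.cost + f.cost + 1
  | .mul e f => e.cost + f.cost + 1
  | .div e f => e.cost + f.cost + 1

def Test.cost : Test → ℕ
  | .ile e f => e.cost + f.cost + 1
  | .rle e f => e.cost + f.cost + 1
  | .neg b => b.cost + 1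
  | .conj b d => b.cost + d.cost + 1

/-- Programs. -/
inductive Program where
  | skip
  | iset (x : ℕ) (e : IExp)
  | rset (x : ℕ) (e : RExp)
  | iput (a : ℕ) (i : IExp) (e : IExp)
  | rput (a : ℕ) (i : IExp) (e : RExp)
  | seq (p q : Program)
  | cond (b : Test) (p q : Program)
  | loop (b : Test) (p : Program)

def Store.iset (s : Store) (x v : ℕ) : Store :=
  { s with ireg := Function.update s.ireg x v }

noncomputable def Store.rset (s : Store) (x : ℕ) (v : ℝ) : Store :=
  { s with rreg := Function.update s.rreg x v }

def Store.iput (s : Store) (a i v : ℕ) : Store :=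
  { s with iarr := Function.update s.iarr a (Function.update (s.iarr a) i v) }

noncomputable def Store.rput (s : Store) (a i : ℕ) (v : ℝ) : Store :=
  { s with rarr := Function.update s.rarr a (Function.update (s.rarr a) i v) }

/-- `Exec p s τ s'`: started in the memory `s`, the program `p` halts in the memory `s'` after
exactly `τ` units of time.  Here `loop b p` repeats `p` as long as `b` holds. -/
inductive Exec : Program → Store → ℕ → Store → Prop
  | skip (s : Store) : Exec .skip s 1 s
  | iset (x : ℕ) (e : IExp) (s : Store) :
      Exec (.iset x e) s (e.cost + 1) (s.iset x (e.eval s))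
  | rset (x : ℕ) (e : RExp) (s : Store) :
      Exec (.rset x e) s (e.cost + 1) (s.rset x (e.eval s))
  | iput (a : ℕ) (i e : IExp) (s : Store) :
      Exec (.iput a i e) s (i.cost + e.cost + 1) (s.iput a (i.eval s) (e.eval s))
  | rput (a : ℕ) (i : IExp) (e : RExp) (s : Store) :
      Exec (.rput a i e) s (i.cost + e.cost + 1) (s.rput a (i.eval s) (e.eval s))
  | seq {p q : Program} {s s' s'' : Store} {τ τ' : ℕ} :
      Exec p s τ s' → Exec q s' τ' s'' → Exec (.seq p q) s (τ + τ') s''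
  | cond_true {b : Test} {p q : Program} {s s' : Store} {τ : ℕ} :
      b.Holds s → Exec p s τ s' → Exec (.cond b p q) s (b.cost + τ) s'
  | cond_false {b : Test} {p q : Program} {s s' : Store} {τ : ℕ} :
      ¬ b.Holds s → Exec q s τ s' → Exec (.cond b p q) s (b.cost + τ) s'
  | loop_true {b : Test} {p : Program} {s s' s'' : Store} {τ τ' : ℕ} :
      b.Holds s → Exec p s τ s' → Exec (.loop b p) s' τ' s'' →
        Exec (.loop b p) s (b.cost + τ + τ') s''
  | loop_false {b : Test} {p : Program} {s : Store} :
      ¬ b.Holds s → Exec (.loop b p) s b.cost s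

end RealRAM

/-! ## Input and output conventions -/

namespace Auction

open RealRAM

/-- The numbers `c` of types and `m` of bidders, the type distribution and the reduced form are
stored in `s`; nothing is assumed about the other cells. -/
def HoldsInstance (s : Store) {c : ℕ} (m : ℕ) (μ π : Fin c → ℝ) : Prop :=
  s.ireg 0 = c ∧ s.ireg 1 = m ∧ (∀ A : Fin c, s.rarr 0 A = μ A) ∧ (∀ A : Fin c, s.rarr 1 A = π A)

/-- Levels are encoded as the integers `0, …, c - 1`, and `LOSE` as `c`. -/
def encodeLevel {c : ℕ} : Level c → ℕ
  | none => c
  | some a => (a : ℕ)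

/-- The description `D` is stored in `s`: the number of hierarchies, their probabilities, and the
table of the levels, hierarchy after hierarchy. -/
def HoldsDescription (s : Store) {c : ℕ} (D : Description c) : Prop :=
  s.ireg 2 = D.size ∧ (∀ k : Fin D.size, s.rarr 2 k = D.prob k) ∧
    ∀ (k : Fin D.size) (A : Fin c), s.iarr 0 ((k : ℕ) * c + A) = encodeLevel (D.level k A)

/-- The input of the mechanism at auction time: `c`, `m`, its description, the reported type
profile, and a random real `u`. -/
def HoldsAuction (s : Store) {m c : ℕ} (D : Description c) (t : Fin m → Fin c) (u : ℝ) : Prop :=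
  s.ireg 0 = c ∧ s.ireg 1 = m ∧ HoldsDescription s D ∧
    (∀ i : Fin m, s.iarr 1 i = (t i : ℕ)) ∧ s.rreg 0 = u

/-- The subset `W` of the bidders is stored in `s` by its indicator. -/
def HoldsSubset (s : Store) {m : ℕ} (W : Finset (Fin m)) : Prop :=
  ∀ i : Fin m, s.iarr 2 i = if i ∈ W then 1 else 0

/-- The program decides feasibility of the reduced form stored in `s` within time `bound`, and outputs
a separating hyperplane (its coefficients and its right-hand side) if it is infeasible. -/
def DecidesOrSeparates (p : Program) (s : Store) (bound : ℝ) {c : ℕ} (m : ℕ) (μ π : Fin c → ℝ) :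
    Prop :=
  ∃ (τ : ℕ) (s' : Store), Exec p s τ s' ∧ (τ : ℝ) ≤ bound ∧
    ((s'.ireg 2 = 1 ∧ π ∈ feasibleForms m μ) ∨
      (s'.ireg 2 = 0 ∧ π ∉ feasibleForms m μ ∧
        Separates (fun A : Fin c => s'.rarr 2 A) (s'.rreg 0) π (feasibleForms m μ)))

end Auction

/-!
Feasible reduced forms are those that satisfy Border's condition
`m * ∑ A ∈ S, μ A * π A ≤ 1 - (1 - ∑ A ∈ S, μ A) ^ m`
for all sets `S` of types: bidders with types in `S` cannot win more often than there are such bidders (`border_of_feasible`).  Sufficiency and the construction of a mechanism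
both come from a greedy decomposition.

A nonnegative vector `x` is turned into a hierarchy by ordering the types by decreasing value of
`x`, types with equal values sharing a level and types at which `x` vanishes losing.  Its interim
winning probabilities `val m μ x` have two properties.  They are strictly increasing in the value
of `x` (`val_lt_val`), being slopes of consecutive chords of the convex function `s ↦ s ^ m`; and
Border's condition is tight for them on the upper sets of `x` (`border_eq_val`).  Hence, if `x`
satisfies Border's condition scaled by a budget `r`, then `x - α * val m μ x` satisfies it with the
budget `r - α`, as long as `α` is not larger than `r` and no entry becomes negative and no two
entries change their order: the upper sets of the new vector are upper sets of `x`, and on these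
both sides of the condition drop by the same amount (`Implementable.step`).  If `α` is maximal,
then either the budget is used up, which forces the remainder to vanish, or some entry vanishes or
merges with another value.  So the number of different positive values decreases (`potential_step`),
nothing is left after `c` steps, and one more step spends the rest of the budget on the hierarchy
in which everybody loses; this gives `c + 1` hierarchies.  Types of probability zero do not enter
Border's condition and would break the strict monotonicity; they are put on top of the hierarchy,
where they win for certain (`IsNormal`).  If there is just one bidder, the function `s ↦ s ^ m` is
not strictly convex, and all types are treated like that.

The greedy decomposition uses Border's condition only for upper sets of `π`.  A program can
therefore decide feasibility by sorting the types by decreasing value of `π` and checking the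
condition for the initial segments; a violated instance is itself a separating hyperplane
(`run_decideCode`).  A described mechanism is run by inverse transform sampling of the index of a
hierarchy.

The programs are written in a fragment (`RealRAM.Code`) whose only loops are counting loops.  Their
meaning is a total function on stores (`Code.run`), loops are treated with an invariant rule
(`Code.rep_induction`), and the running time is bounded by an expression in the contents of the
registers that bound the loops (`Code.exec_toProgram`, `Code.time_le`).
-/

namespace RealRAM

/-! ### Structured programs -/

section StoreLemmas

variable (s : Store) (x y a b i j v : ℕ) (z : ℝ)

@[simp] theorem Store.iset_ireg : (s.iset x v).ireg y = if y = x then v else s.ireg y :=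
  Function.update_apply ..

@[simp] theorem Store.iset_rreg : (s.iset x v).rreg = s.rreg := rfl
@[simp] theorem Store.iset_iarr : (s.iset x v).iarr = s.iarr := rfl
@[simp] theorem Store.iset_rarr : (s.iset x v).rarr = s.rarr := rfl

@[simp] theorem Store.rset_rreg : (s.rset x z).rreg y = if y = x then z else s.rreg y :=
  Function.update_apply ..

@[simp] theorem Store.rset_ireg : (s.rset x z).ireg = s.ireg := rfl
@[simp] theorem Store.rset_iarr : (s.rset x z).iarr = s.iarr := rfl
@[simp] theorem Store.rset_rarr : (s.rset x z).rarr = s.rarr := rfl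

@[simp] theorem Store.iput_iarr : (s.iput a i v).iarr b j =
    if b = a then if j = i then v else s.iarr b j else s.iarr b j := by
  unfold Store.iput
  by_cases h : b = a
  · subst h; simp [Function.update_apply]
  · simp [h]

@[simp] theorem Store.iput_ireg : (s.iput a i v).ireg = s.ireg := rfl
@[simp] theorem Store.iput_rreg : (s.iput a i v).rreg = s.rreg := rfl
@[simp] theorem Store.iput_rarr : (s.iput a i v).rarr = s.rarr := rfl

@[simp] theorem Store.rput_rarr : (s.rput a i z).rarr b j =
    if b = a then if j = i then z else s.rarr b j else s.rarr b j := by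
  unfold Store.rput
  by_cases h : b = a
  · subst h; simp [Function.update_apply]
  · simp [h]

@[simp] theorem Store.rput_ireg : (s.rput a i z).ireg = s.ireg := rfl
@[simp] theorem Store.rput_rreg : (s.rput a i z).rreg = s.rreg := rfl
@[simp] theorem Store.rput_iarr : (s.rput a i z).iarr = s.iarr := rfl

section Ite

variable {P : Prop} [Decidable P] (s' : Store)

@[simp] theorem Store.ite_ireg :
    (if P then s else s').ireg x = if P then s.ireg x else s'.ireg x := by split_ifs <;> rfl

@[simp] theorem Store.ite_rreg :
    (if P then s else s').rreg x = if P then s.rreg x else s'.rreg x := by split_ifs <;> rfl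

@[simp] theorem Store.ite_iarr :
    (if P then s else s').iarr a i = if P then s.iarr a i else s'.iarr a i := by split_ifs <;> rfl

@[simp] theorem Store.ite_rarr :
    (if P then s else s').rarr a i = if P then s.rarr a i else s'.rarr a i := by split_ifs <;> rfl

end Ite

end StoreLemmas

/-- Strict comparison of reals. -/
def Test.rlt (e f : RExp) : Test := .neg (.rle f e)

/-- Strict comparison of integers. -/
def Test.ilt (e f : IExp) : Test := .neg (.ile f e)

/-- Disjunction of tests. -/
def Test.disj (b d : Test) : Test := .neg (.conj (.neg b) (.neg d))

section Holds

variable (s : Store) (b d : Test)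

@[simp] theorem Test.holds_ile (e f : IExp) : (Test.ile e f).Holds s ↔ e.eval s ≤ f.eval s :=
  Iff.rfl

@[simp] theorem Test.holds_rle (e f : RExp) : (Test.rle e f).Holds s ↔ e.eval s ≤ f.eval s :=
  Iff.rfl

@[simp] theorem Test.holds_neg : b.neg.Holds s ↔ ¬ b.Holds s := Iff.rfl

@[simp] theorem Test.holds_conj : (b.conj d).Holds s ↔ b.Holds s ∧ d.Holds s := Iff.rfl

@[simp] theorem Test.holds_rlt (e f : RExp) : (Test.rlt e f).Holds s ↔ e.eval s < f.eval s := by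
  simp [Test.rlt]

@[simp] theorem Test.holds_ilt (e f : IExp) : (Test.ilt e f).Holds s ↔ e.eval s < f.eval s := by
  simp [Test.ilt]

@[simp] theorem Test.holds_disj : (b.disj d).Holds s ↔ b.Holds s ∨ d.Holds s := by
  simp only [Test.disj, Test.holds_neg, Test.holds_conj]; tauto

end Holds

/-- Programs whose only loops are counting loops: `rep x y p` runs `p` with register `x` holding
`0, 1, …, N - 1`, where `N` is the content of register `y` at the start.  They always halt, so they
have a meaning as total functions on stores. -/
inductive Code where
  | skip
  | iset (x : ℕ) (e : IExp)
  | rset (x : ℕ) (e : RExp)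
  | iput (a : ℕ) (i : IExp) (e : IExp)
  | rput (a : ℕ) (i : IExp) (e : RExp)
  | seq (p q : Code)
  | cond (b : Test) (p q : Code)
  | rep (x y : ℕ) (p : Code)

/-- Sequential composition. -/
infixr:60 " ;; " => Code.seq

namespace Code

/-- The loop by which the counting loop `rep x y p` is implemented. -/
def whileLess (x y : ℕ) (p : Program) : Program :=
  .loop (.ile (.add (.reg x) (.lit 1)) (.reg y)) (.seq p (.iset x (.add (.reg x) (.lit 1))))

/-- Translation into programs of the machine. -/
def toProgram : Code → Program
  | skip => .skip
  | iset x e => .iset x e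
  | rset x e => .rset x e
  | iput a i e => .iput a i e
  | rput a i e => .rput a i e
  | seq p q => .seq p.toProgram q.toProgram
  | cond b p q => .cond b p.toProgram q.toProgram
  | rep x y p => .seq (.iset x (.lit 0)) (whileLess x y p.toProgram)

/-- The store after `n` rounds of a counting loop with counter `x` and body `f`. -/
def iter (f : Store → Store) (x : ℕ) (s : Store) : ℕ → Store
  | 0 => s.iset x 0
  | n + 1 => (f (iter f x s n)).iset x (n + 1)

open Classical in
/-- The memory in which the program ends. -/
noncomputable def run : Code → Store → Store
  | skip, s => s
  | iset x e, s => s.iset x (e.eval s)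
  | rset x e, s => s.rset x (e.eval s)
  | iput a i e, s => s.iput a (i.eval s) (e.eval s)
  | rput a i e, s => s.rput a (i.eval s) (e.eval s)
  | seq p q, s => q.run (p.run s)
  | cond b p q, s => if b.Holds s then p.run s else q.run s
  | rep x y p, s => iter p.run x s (s.ireg y)

/-- The parts of the memory that a program can write to: registers and whole arrays. -/
inductive Cell where
  | ireg (x : ℕ)
  | rreg (x : ℕ)
  | iarr (a : ℕ)
  | rarr (a : ℕ)
  deriving DecidableEq

/-- The stores `s` and `s'` agree on a part of the memory. -/
def Agree (s s' : Store) : Cell → Prop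
  | .ireg x => s.ireg x = s'.ireg x
  | .rreg x => s.rreg x = s'.rreg x
  | .iarr a => s.iarr a = s'.iarr a
  | .rarr a => s.rarr a = s'.rarr a

/-- Does the program write to the given part of the memory? -/
def writes : Code → Cell → Bool
  | skip, _ => false
  | iset x _, v => v = .ireg x
  | rset x _, v => v = .rreg x
  | iput a _ _, v => v = .iarr a
  | rput a _ _, v => v = .rarr a
  | seq p q, v => p.writes v || q.writes v
  | cond _ p q, v => p.writes v || q.writes v
  | rep x _ p, v => decide (v = .ireg x) || p.writes v

/-- Two stores agree outside of what `p` writes to. -/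
def Frame (p : Code) (s s' : Store) : Prop := ∀ v, p.writes v = false → Agree s s' v

theorem Agree.refl (s : Store) (v : Cell) : Agree s s v := by cases v <;> rfl

theorem Agree.trans {s s' s'' : Store} {v : Cell} (h : Agree s s' v) (h' : Agree s' s'' v) :
    Agree s s'' v := by
  cases v <;> exact Eq.trans (show _ = _ from h) (show _ = _ from h')

theorem agree_iset {s : Store} {v : Cell} {x n : ℕ} (h : v ≠ .ireg x) :
    Agree (s.iset x n) s v := by
  cases v with
  | ireg y => simpa [Agree] using fun e => (h (by rw [e])).elim
  | _ => rfl

theorem agree_iter {f : Store → Store} {x : ℕ} {v : Cell} (hv : v ≠ .ireg x)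
    (hf : ∀ s, Agree (f s) s v) (s : Store) (n : ℕ) : Agree (iter f x s n) s v := by
  induction n with
  | zero => exact agree_iset hv
  | succ n ih => exact (agree_iset hv).trans ((hf _).trans ih)

theorem agree_run (p : Code) {v : Cell} (h : p.writes v = false) (s : Store) :
    Agree (p.run s) s v := by
  induction p generalizing s with
  | skip => exact Agree.refl s v
  | iset x e => exact agree_iset (by simpa [writes] using h)
  | rset x e =>
    cases v with
    | rreg y =>
      simp only [writes, decide_eq_false_iff_not, Cell.rreg.injEq] at h; simp [Agree, run, h]
    | _ => rfl
  | iput a i e =>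
    cases v with
    | iarr y =>
      simp only [writes, decide_eq_false_iff_not, Cell.iarr.injEq] at h; funext j; simp [run, h]
    | _ => rfl
  | rput a i e =>
    cases v with
    | rarr y =>
      simp only [writes, decide_eq_false_iff_not, Cell.rarr.injEq] at h; funext j; simp [run, h]
    | _ => rfl
  | seq p q ihp ihq =>
    simp only [writes, Bool.or_eq_false_iff] at h
    exact (ihq h.2 _).trans (ihp h.1 _)
  | cond b p q ihp ihq =>
    simp only [writes, Bool.or_eq_false_iff] at h
    unfold run
    split_ifs
    exacts [ihp h.1 _, ihq h.2 _]
  | rep x y p ih =>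
    simp only [writes, Bool.or_eq_false_iff, decide_eq_false_iff_not] at h
    exact agree_iter h.1 (ih h.2) _ _

theorem frame_run (p : Code) (s : Store) : p.Frame (p.run s) s := fun _ h => p.agree_run h s

section Frame

variable {p : Code} {s s' : Store} (h : p.Frame s s')
include h

theorem Frame.ireg (x : ℕ) (hx : p.writes (.ireg x) = false) : s.ireg x = s'.ireg x := h _ hx
theorem Frame.rreg (x : ℕ) (hx : p.writes (.rreg x) = false) : s.rreg x = s'.rreg x := h _ hx
theorem Frame.iarr (a : ℕ) (ha : p.writes (.iarr a) = false) : s.iarr a = s'.iarr a := h _ ha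
theorem Frame.rarr (a : ℕ) (ha : p.writes (.rarr a) = false) : s.rarr a = s'.rarr a := h _ ha

end Frame

/-- The invariant rule for counting loops. -/
theorem rep_induction (x y : ℕ) (p : Code) (s : Store)
    (I : ℕ → Store → Prop)
    (h0 : I 0 (s.iset x 0))
    (hstep : ∀ i < s.ireg y, ∀ s', s'.ireg x = i → (rep x y p).Frame s' s → I i s' →
      I (i + 1) ((p.run s').iset x (i + 1))) :
    I (s.ireg y) ((rep x y p).run s) := by
  have key : ∀ n ≤ s.ireg y, I n (iter p.run x s n) := by
    intro n
    induction n with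
    | zero => exact fun _ => h0
    | succ n ih =>
      intro hn
      refine hstep n hn _ ?_ ?_ (ih (by omega))
      · cases n <;> simp [iter]
      · intro v hv
        simp only [writes, Bool.or_eq_false_iff, decide_eq_false_iff_not] at hv
        exact agree_iter hv.1 (p.agree_run hv.2) _ _
  exact key _ le_rfl

/-- Is register `y` the bound of a counting loop in the program? -/
def bounds : Code → ℕ → Bool
  | seq p q, y => p.bounds y || q.bounds y
  | cond _ p q, y => p.bounds y || q.bounds y
  | rep _ z p, y => decide (y = z) || p.bounds y
  | _, _ => false

/-- No counter is overwritten by the body of its loop. -/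
def KeepsCounters : Code → Bool
  | seq p q => p.KeepsCounters && q.KeepsCounters
  | cond _ p q => p.KeepsCounters && q.KeepsCounters
  | rep x _ p => !p.writes (.ireg x) && p.KeepsCounters
  | _ => true

/-- An upper bound for the running time in terms of the contents of the registers that bound the
counting loops, for programs that do not write to these registers.  In `rep`, the test costs `5`,
increasing the counter `4`, and the initialization `2`. -/
def time (env : ℕ → ℕ) : Code → ℕ
  | skip => 1
  | iset _ e => e.cost + 1
  | rset _ e => e.cost + 1
  | iput _ i e => i.cost + e.cost + 1
  | rput _ i e => i.cost + e.cost + 1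
  | seq p q => p.time env + q.time env
  | cond b p q => b.cost + (p.time env + q.time env)
  | rep _ y p => env y * (p.time env + 9) + 7

theorem time_congr {env env' : ℕ → ℕ} (p : Code) (h : ∀ y, p.bounds y → env y = env' y) :
    p.time env = p.time env' := by
  induction p with
  | seq p q ihp ihq | cond b p q ihp ihq =>
    simp only [bounds, Bool.or_eq_true] at h
    simp only [time]
    rw [ihp fun y hy => h y (.inl hy), ihq fun y hy => h y (.inr hy)]
  | rep x y p ih =>
    simp only [bounds, Bool.or_eq_true, decide_eq_true_eq] at h
    simp only [time]
    rw [ih fun z hz => h z (.inr hz), h y (.inl rfl)]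
  | _ => rfl

/-- Structured programs halt, in the store given by `Code.run` and within the time given by
`Code.time`. -/
theorem exec_toProgram (p : Code) (hp : p.KeepsCounters)
    (hb : ∀ y, p.bounds y → p.writes (.ireg y) = false) (s : Store) :
    ∃ τ ≤ p.time s.ireg, Exec p.toProgram s τ (p.run s) := by
  induction p generalizing s with
  | skip => exact ⟨_, le_rfl, .skip s⟩
  | iset x e => exact ⟨_, le_rfl, .iset x e s⟩
  | rset x e => exact ⟨_, le_rfl, .rset x e s⟩
  | iput a i e => exact ⟨_, le_rfl, .iput a i e s⟩
  | rput a i e => exact ⟨_, le_rfl, .rput a i e s⟩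
  | seq p q ihp ihq =>
    simp only [KeepsCounters, Bool.and_eq_true] at hp
    simp only [bounds, writes, Bool.or_eq_true, Bool.or_eq_false_iff] at hb
    obtain ⟨τ, hτ, hE⟩ := ihp hp.1 (fun y hy => (hb y (.inl hy)).1) s
    obtain ⟨τ', hτ', hE'⟩ := ihq hp.2 (fun y hy => (hb y (.inr hy)).2) (p.run s)
    rw [q.time_congr (env' := s.ireg) fun y hy => p.agree_run (hb y (.inr hy)).1 s] at hτ'
    exact ⟨_, add_le_add hτ hτ', .seq hE hE'⟩
  | cond b p q ihp ihq =>
    simp only [KeepsCounters, Bool.and_eq_true] at hp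
    simp only [bounds, writes, Bool.or_eq_true, Bool.or_eq_false_iff] at hb
    obtain ⟨τ, hτ, hE⟩ := ihp hp.1 (fun y hy => (hb y (.inl hy)).1) s
    obtain ⟨τ', hτ', hE'⟩ := ihq hp.2 (fun y hy => (hb y (.inr hy)).2) s
    unfold run
    split_ifs with h
    · exact ⟨_, by simp only [time]; omega, .cond_true h hE⟩
    · exact ⟨_, by simp only [time]; omega, .cond_false h hE'⟩
  | rep x y p ih =>
    simp only [KeepsCounters, Bool.and_eq_true, Bool.not_eq_true'] at hp
    simp only [bounds, writes, Bool.or_eq_true, Bool.or_eq_false_iff, decide_eq_true_eq,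
      decide_eq_false_iff_not] at hb
    have hreg : ∀ z, (rep x y p).bounds z → ∀ n, (iter p.run x s n).ireg z = s.ireg z := by
      intro z hz n
      simp only [bounds, Bool.or_eq_true, decide_eq_true_eq] at hz
      exact agree_iter (hb z hz).1 (p.agree_run (hb z hz).2) s n
    have hcount : ∀ n, (iter p.run x s n).ireg x = n := by
      intro n; cases n <;> simp [iter]
    have hbody : ∀ n, ∃ τ ≤ p.time s.ireg,
        Exec p.toProgram (iter p.run x s n) τ (p.run (iter p.run x s n)) := by
      intro n
      obtain ⟨τ, hτ, hE⟩ := ih hp.2 (fun z hz => (hb z (.inr hz)).2) (iter p.run x s n)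
      refine ⟨τ, hτ.trans (p.time_congr fun z hz => hreg z ?_ n).le, hE⟩
      simp [bounds, hz]
    have hloop : ∀ d n, n + d = s.ireg y → ∃ τ ≤ d * (p.time s.ireg + 9) + 5,
        Exec (whileLess x y p.toProgram) (iter p.run x s n) τ (iter p.run x s (n + d)) := by
      intro d
      induction d with
      | zero =>
        intro n hn
        refine ⟨_, ?_, .loop_false ?_⟩
        · simp [Test.cost, IExp.cost]
        · have h1 := hreg y (by simp [bounds]) n
          simp [IExp.eval, hcount, h1]; omega
      | succ d ihd =>
        intro n hn
        obtain ⟨τ, hτ, hE⟩ := hbody n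
        obtain ⟨τ', hτ', hE'⟩ := ihd (n + 1) (by omega)
        have hE'' : Exec (.seq p.toProgram (.iset x (.add (.reg x) (.lit 1)))) (iter p.run x s n)
            (τ + 4) (iter p.run x s (n + 1)) := by
          refine .seq hE ?_
          have h := Exec.iset x (.add (.reg x) (.lit 1)) (p.run (iter p.run x s n))
          have hx : (p.run (iter p.run x s n)).ireg x = n :=
            Eq.trans (p.agree_run hp.1 _) (hcount n)
          simpa [IExp.eval, hx, IExp.cost, iter] using h
        rw [show n + (d + 1) = n + 1 + d by omega]
        refine ⟨_, ?_, .loop_true ?_ hE'' hE'⟩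
        · simp only [Test.cost, IExp.cost]; nlinarith
        · have h1 := hreg y (by simp [bounds]) n
          simp [IExp.eval, hcount, h1]; omega
    obtain ⟨τ, hτ, hE⟩ := hloop (s.ireg y) 0 (by simp)
    refine ⟨2 + τ, ?_, .seq (.iset x (.lit 0) s) ?_⟩
    · simp only [time]; omega
    · simpa [IExp.eval, run, iter] using hE

/-- The depth to which the counting loops are nested. -/
def depth : Code → ℕ
  | seq p q => max p.depth q.depth
  | cond _ p q => max p.depth q.depth
  | rep _ _ p => p.depth + 1
  | _ => 0

/-- The coefficient in the polynomial bound `Code.time_le` for the running time. -/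
def weight : Code → ℕ
  | skip => 1
  | iset _ e => e.cost + 1
  | rset _ e => e.cost + 1
  | iput _ i e => i.cost + e.cost + 1
  | rput _ i e => i.cost + e.cost + 1
  | seq p q => p.weight + q.weight
  | cond b p q => b.cost + (p.weight + q.weight)
  | rep _ _ p => p.weight + 16

theorem time_le {env : ℕ → ℕ} {M : ℕ} (hM : 1 ≤ M) (p : Code)
    (h : ∀ y, p.bounds y → env y ≤ M) : p.time env ≤ p.weight * M ^ p.depth := by
  induction p with
  | seq p q ihp ihq | cond b p q ihp ihq =>
    simp only [bounds, Bool.or_eq_true] at h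
    have h1 := ihp fun y hy => h y (.inl hy)
    have h2 := ihq fun y hy => h y (.inr hy)
    have h3 : M ^ p.depth ≤ M ^ max p.depth q.depth := Nat.pow_le_pow_right hM (le_max_left ..)
    have h4 : M ^ q.depth ≤ M ^ max p.depth q.depth := Nat.pow_le_pow_right hM (le_max_right ..)
    have h5 : 1 ≤ M ^ max p.depth q.depth := Nat.one_le_pow _ _ hM
    simp only [time, weight, depth]
    nlinarith [Nat.mul_le_mul_left p.weight h3, Nat.mul_le_mul_left q.weight h4]
  | rep x y p ih =>
    simp only [bounds, Bool.or_eq_true, decide_eq_true_eq] at h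
    have h1 := ih fun z hz => h z (.inr hz)
    have h5 : 1 ≤ M ^ p.depth := Nat.one_le_pow _ _ hM
    simp only [time, weight, depth]
    calc env y * (p.time env + 9) + 7
        ≤ M * (p.weight * M ^ p.depth + 9 * M ^ p.depth) + 7 * (M * M ^ p.depth) := by
          gcongr
          · exact h y (.inl rfl)
          · omega
          · nlinarith
      _ = (p.weight + 16) * M ^ (p.depth + 1) := by ring
  | _ => simp [time, weight, depth]

end Code
end RealRAM

namespace Auction

/-! ### Interim winning probabilities -/

section Interim

variable {T : Type*} [Fintype T] [DecidableEq T] {m : ℕ} {μ : T → ℝ}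

/-- The interim winning probability as an expectation over the types of all bidders, the type of
bidder `i` being replaced by `A`. -/
theorem interim_eq_sum_update (hμ : IsDistribution μ) (φ : (Fin m → T) → Fin m → ℝ) (i : Fin m)
    (A : T) :
    interim μ φ i A = ∑ t : Fin m → T, (∏ j, μ (t j)) * φ (Function.update t i A) i := by
  have hfib : ∀ B, ∑ t : Fin m → T with t i = B,
      (∏ j ∈ univ.erase i, μ (t j)) * φ (Function.update t i A) i = interim μ φ i A := by
    intro B
    rw [interim, ← sum_filter]
    refine sum_bij' (fun t _ => Function.update t i A) (fun t _ => Function.update t i B)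
      (by simp) (by simp) ?_ ?_ ?_
    · intro t ht
      simp only [mem_filter, mem_univ, true_and] at ht
      simp [← ht]
    · intro t ht
      simp only [mem_filter, mem_univ, true_and] at ht
      simp [← ht]
    · intro t _
      congr 1
      exact prod_congr rfl fun j hj => by rw [Function.update_of_ne (ne_of_mem_erase hj)]
  calc interim μ φ i A = ∑ B, μ B * interim μ φ i A := by rw [← sum_mul, hμ.2, one_mul]
    _ = ∑ B, ∑ t : Fin m → T, if t i = B then
          μ B * ((∏ j ∈ univ.erase i, μ (t j)) * φ (Function.update t i A) i) else 0 := by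
        refine sum_congr rfl fun B _ => ?_
        rw [← hfib B, mul_sum, sum_filter]
    _ = _ := by
        rw [sum_comm]
        refine sum_congr rfl fun t _ => ?_
        rw [sum_ite_eq, if_pos (mem_univ _), ← mul_assoc,
          mul_prod_erase _ (fun j => μ (t j)) (mem_univ i)]

/-- The probability that bidder `i` has a type in `S` and gets the item. -/
theorem sum_mul_interim (φ : (Fin m → T) → Fin m → ℝ) (i : Fin m) (S : Finset T) :
    ∑ A ∈ S, μ A * interim μ φ i A =
      ∑ t : Fin m → T, (∏ j, μ (t j)) * if t i ∈ S then φ t i else 0 := by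
  simp only [interim, mul_sum, mul_ite, mul_zero]
  rw [sum_comm]
  refine sum_congr rfl fun t _ => ?_
  rw [sum_ite_eq]
  split_ifs
  · rw [← mul_assoc, mul_prod_erase _ (fun j => μ (t j)) (mem_univ i)]
  · rfl

open Classical in
/-- The probability that some bidder has a type in `S`. -/
theorem sum_prod_exists_mem (hμ : IsDistribution μ) (S : Finset T) :
    ∑ t : Fin m → T, (∏ j, μ (t j)) * (if ∃ i, t i ∈ S then 1 else 0) =
      1 - (1 - ∑ A ∈ S, μ A) ^ m := by
  have h1 : (1 - ∑ A ∈ S, μ A) = ∑ A, if A ∈ S then 0 else μ A := by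
    rw [sum_ite, sum_const_zero, zero_add, ← hμ.2, sub_eq_iff_eq_add, add_comm]
    rw [← sum_filter_add_sum_filter_not univ (· ∈ S)]
    simp
  have h2 : (1 : ℝ) = ∑ t : Fin m → T, ∏ j, μ (t j) := by
    rw [← Fintype.sum_pow, hμ.2, one_pow]
  rw [h1, Fintype.sum_pow, eq_sub_iff_add_eq, ← sum_add_distrib]
  refine (sum_congr rfl fun t _ => ?_).trans h2.symm
  split_ifs with h
  · obtain ⟨i, hi⟩ := h
    have h0 : ∏ j, (if t j ∈ S then 0 else μ (t j)) = 0 :=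
      prod_eq_zero (i := i) (mem_univ i) (by simp [hi])
    rw [h0]
    ring
  · push Not at h
    simp [h]

/-- Necessity of Border's condition: bidders with types in `S` do not win more often than there
are such bidders. -/
theorem border_of_feasible (hμ : IsDistribution μ) {π : T → ℝ} (hπ : π ∈ feasibleForms m μ)
    (S : Finset T) : m * ∑ A ∈ S, μ A * π A ≤ 1 - (1 - ∑ A ∈ S, μ A) ^ m := by
  classical
  obtain ⟨-, M, hM⟩ := hπ
  calc m * ∑ A ∈ S, μ A * π A = ∑ _i : Fin m, ∑ A ∈ S, μ A * π A := by simp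
    _ ≤ ∑ i, ∑ A ∈ S, μ A * interim μ M.alloc i A :=
        sum_le_sum fun i _ => sum_le_sum fun A _ => mul_le_mul_of_nonneg_left (hM i A) (hμ.1 A)
    _ = ∑ t : Fin m → T, (∏ j, μ (t j)) * ∑ i, if t i ∈ S then M.alloc t i else 0 := by
        simp only [sum_mul_interim, mul_sum]
        exact sum_comm
    _ ≤ ∑ t : Fin m → T, (∏ j, μ (t j)) * (if ∃ i, t i ∈ S then 1 else 0) := by
        refine sum_le_sum fun t _ => mul_le_mul_of_nonneg_left ?_ (prod_nonneg fun j _ => hμ.1 _)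
        split_ifs with h
        · refine le_trans (sum_le_sum fun i _ => ?_) (M.sum_le_one t)
          split_ifs
          exacts [le_rfl, M.nonneg t i]
        · push Not at h
          simp [h]
    _ = _ := sum_prod_exists_mem hμ S

end Interim

/-! ### Hierarchical mechanisms -/

section Hierarchical

variable {c m : ℕ} {μ : Fin c → ℝ} {H : Fin c → Level c}

/-- The interim winning probability in the hierarchical mechanism given by `H`. -/
noncomputable def winProb (μ : Fin c → ℝ) (H : Fin c → Level c) (i : Fin m) (A : Fin c) : ℝ :=
  interim μ (fun t i => share (winners H t) i) i A

theorem mem_winners {t : Fin m → Fin c} {i : Fin m} :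
    i ∈ winners H t ↔ H (t i) ≠ ⊤ ∧ ∀ j, H (t i) ≤ H (t j) := by simp [winners]

theorem winProb_congr (hμ : IsDistribution μ) (i : Fin m) {A B : Fin c} (h : H A = H B) :
    winProb μ H i A = winProb μ H i B := by
  simp only [winProb, interim_eq_sum_update hμ]
  refine sum_congr rfl fun t _ => ?_
  have hH : ∀ j, H (Function.update t i A j) = H (Function.update t i B j) := by
    intro j
    by_cases hj : j = i
    · subst hj; simpa using h
    · simp [hj]
  have hw : winners H (Function.update t i A) = winners H (Function.update t i B) := by
    ext j; simp only [mem_winners, hH]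
  rw [hw]

theorem share_winners_comp (t : Fin m → Fin c) (σ : Equiv.Perm (Fin m)) (i : Fin m) :
    share (winners H (t ∘ σ)) i = share (winners H t) (σ i) := by
  have hmem : ∀ j, j ∈ winners H (t ∘ σ) ↔ σ j ∈ winners H t := by
    intro j
    simp only [mem_winners, Function.comp_apply]
    refine and_congr_right fun _ => ⟨fun h k => ?_, fun h k => h _⟩
    simpa using h (σ.symm k)
  have hcard : (winners H (t ∘ σ)).card = (winners H t).card := by
    refine card_bij (fun j _ => σ j) (fun j hj => (hmem j).1 hj) (fun _ _ _ _ h => σ.injective h) ?_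
    intro k hk
    exact ⟨σ.symm k, (hmem _).2 (by simpa using hk), by simp⟩
  simp only [share, hmem, hcard]

theorem winProb_symm (hμ : IsDistribution μ) (i i' : Fin m) (A : Fin c) :
    winProb μ H i A = winProb μ H i' A := by
  simp only [winProb, interim_eq_sum_update hμ]
  set σ : Equiv.Perm (Fin m) := Equiv.swap i i' with hσ
  rw [← Equiv.sum_comp (σ.arrowCongr (Equiv.refl (Fin c)))]
  refine sum_congr rfl fun t _ => ?_
  have h1 : ∏ j, μ ((σ.arrowCongr (Equiv.refl (Fin c))) t j) = ∏ j, μ (t j) := by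
    simpa using Equiv.prod_comp σ.symm fun j => μ (t j)
  have h2 : Function.update ((σ.arrowCongr (Equiv.refl (Fin c))) t) i A =
      Function.update t i' A ∘ σ := by
    funext j
    have hs : σ.symm = σ := by simp [hσ]
    by_cases hj : j = i
    · subst hj; simp [hσ]
    · have : σ j ≠ i' := fun h => hj (by rw [← σ.injective.eq_iff, h]; simp [hσ])
      simp [hj, this, hs]
  rw [h1, h2, share_winners_comp]
  simp [hσ]

theorem winProb_of_eq_top (i : Fin m) {A : Fin c} (h : H A = ⊤) : winProb μ H i A = 0 := by
  rw [winProb, interim]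
  refine sum_eq_zero fun t _ => ?_
  split_ifs with ht
  · have : i ∉ winners H t := by simp [mem_winners, ht, h]
    simp [share, this]
  · rfl

theorem winProb_of_top_priority (hμ : IsDistribution μ) (i : Fin m) {A : Fin c} (h : H A ≠ ⊤)
    (h' : m = 1 ∨ ∀ B, 0 < μ B → H A < H B) : winProb μ H i A = 1 := by
  rw [winProb, interim_eq_sum_update hμ]
  have key : ∀ t : Fin m → Fin c, (∏ j, μ (t j)) * share (winners H (Function.update t i A)) i =
      ∏ j, μ (t j) := by
    intro t
    by_cases ht : ∀ j, 0 < μ (t j)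
    · have hlt : ∀ j, j ≠ i → H A < H (t j) := by
        intro j hj
        rcases h' with rfl | h'
        · exact absurd (Subsingleton.elim j i) hj
        · exact h' _ (ht j)
      have : winners H (Function.update t i A) = {i} := by
        ext j
        simp only [mem_winners, mem_singleton]
        constructor
        · intro hj
          by_contra hne
          have := hj.2 i
          simp only [Function.update_self, Function.update_of_ne hne] at this
          exact absurd (hlt j hne) this.not_gt
        · rintro rfl
          refine ⟨by simpa using h, fun k => ?_⟩
          by_cases hk : k = j
          · rw [hk]
          · simpa [hk] using (hlt k hk).le
      simp [this, share]
    · push Not at ht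
      obtain ⟨j, hj⟩ := ht
      have : ∏ j, μ (t j) = 0 := prod_eq_zero (mem_univ j) (le_antisymm hj (hμ.1 _))
      simp [this]
  simp only [key]
  rw [← Fintype.sum_pow, hμ.2, one_pow]

theorem winners_nonempty {t : Fin m → Fin c} {i : Fin m} (h : H (t i) ≠ ⊤) :
    (winners H t).Nonempty := by
  obtain ⟨k, -, hk⟩ := exists_min_image univ (fun j => H (t j)) ⟨i, mem_univ i⟩
  refine ⟨k, mem_winners.2 ⟨?_, fun j => hk j (mem_univ j)⟩⟩
  exact ((hk i (mem_univ i)).trans_lt (lt_top_iff_ne_top.2 h)).ne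

theorem sum_share {W : Finset (Fin m)} (hW : W.Nonempty) : ∑ i, share W i = 1 := by
  simp only [share, sum_ite_mem, univ_inter, sum_const, nsmul_eq_mul]
  have : (W.card : ℝ) ≠ 0 := by simpa using hW.ne_empty
  field_simp

/-- If the types in `U` have priority over all others, then the item goes to a bidder with a type
in `U` whenever there is one: Border's condition holds with equality. -/
theorem border_eq_of_priority (hμ : IsDistribution μ) (U : Finset (Fin c))
    (hU : ∀ A ∈ U, H A ≠ ⊤) (hU' : ∀ A ∈ U, ∀ B ∉ U, H A < H B) (i : Fin m) :
    m * ∑ A ∈ U, μ A * winProb μ H i A = 1 - (1 - ∑ A ∈ U, μ A) ^ m := by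
  classical
  calc m * ∑ A ∈ U, μ A * winProb μ H i A = ∑ k : Fin m, ∑ A ∈ U, μ A * winProb μ H k A := by
        simp only [winProb_symm hμ _ i]; simp
    _ = ∑ t : Fin m → Fin c,
          (∏ j, μ (t j)) * ∑ i, if t i ∈ U then share (winners H t) i else 0 := by
        simp only [winProb, sum_mul_interim, mul_sum]
        exact sum_comm
    _ = ∑ t : Fin m → Fin c, (∏ j, μ (t j)) * (if ∃ i, t i ∈ U then 1 else 0) := by
        refine sum_congr rfl fun t _ => ?_
        congr 1
        split_ifs with h
        · obtain ⟨k, hk⟩ := h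
          rw [← sum_share (winners_nonempty (hU _ hk))]
          refine sum_congr rfl fun j _ => ?_
          split_ifs with hj
          · rfl
          · have : j ∉ winners H t := fun h => (mem_winners.1 h).2 k |>.not_gt (hU' _ hk _ hj)
            simp [share, this]
        · push Not at h
          simp [h]
    _ = _ := sum_prod_exists_mem hμ U

end Hierarchical

/-! ### The hierarchy of a vector -/

section Greedy

variable {c m : ℕ} {μ x : Fin c → ℝ} {r α : ℝ}

/-- Types that can be separated from neighbouring types by merging levels.  The remaining types
(those of probability zero, and all types if there is just one bidder) win for certain whenever they
are on top of the hierarchy, without taking anything away from the normal types. -/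
def IsNormal (m : ℕ) (μ : Fin c → ℝ) (A : Fin c) : Prop := 2 ≤ m ∧ 0 < μ A

open Classical in
/-- The number of types with priority over `A` in the hierarchy of `x`: types that are not normal
are on top, normal types are ordered by decreasing values of `x`. -/
noncomputable def rank (m : ℕ) (μ x : Fin c → ℝ) (A : Fin c) : ℕ :=
  #{B | IsNormal m μ A ∧ (¬ IsNormal m μ B ∨ x A < x B)}

theorem rank_lt (m : ℕ) (μ x : Fin c → ℝ) (A : Fin c) : rank m μ x A < c := by
  classical
  have h : A ∉ ({B | IsNormal m μ A ∧ (¬ IsNormal m μ B ∨ x A < x B)} : Finset (Fin c)) := by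
    simp only [mem_filter, mem_univ, true_and, lt_irrefl, or_false]; tauto
  simpa [rank] using card_lt_univ_of_notMem h

/-- The hierarchy of `x`: types at which `x` vanishes lose. -/
noncomputable def lev (m : ℕ) (μ x : Fin c → ℝ) (A : Fin c) : Level c :=
  if x A ≤ 0 then ⊤ else ((⟨rank m μ x A, rank_lt m μ x A⟩ : Fin c) : WithTop (Fin c))

/-- The probability of the types with a larger value of `x`. -/
noncomputable def higher (μ x : Fin c → ℝ) (A : Fin c) : ℝ := ∑ B with x A < x B, μ B

/-- The probability of the types with the same value of `x`. -/
noncomputable def same (μ x : Fin c → ℝ) (A : Fin c) : ℝ := ∑ B with x B = x A, μ B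

open Classical in
/-- The interim winning probabilities in the hierarchical mechanism of `x`. -/
noncomputable def val (m : ℕ) (μ x : Fin c → ℝ) (A : Fin c) : ℝ :=
  if x A ≤ 0 then 0 else if IsNormal m μ A then
    ((1 - higher μ x A) ^ m - (1 - higher μ x A - same μ x A) ^ m) / (m * same μ x A) else 1

theorem eq_zero_of_not_isNormal (hμ : IsDistribution μ) (hm : 2 ≤ m) {A : Fin c}
    (hA : ¬ IsNormal m μ A) : μ A = 0 :=
  le_antisymm (not_lt.1 fun h => hA ⟨hm, h⟩) (hμ.1 A)

theorem rank_le_rank {A B : Fin c} (hB : IsNormal m μ B) (h : x B ≤ x A) :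
    rank m μ x A ≤ rank m μ x B := by
  classical
  refine card_le_card fun C hC => ?_
  simp only [mem_filter, mem_univ, true_and] at hC ⊢
  exact ⟨hB, hC.2.imp_right h.trans_lt⟩

theorem rank_lt_rank {A B : Fin c} (hB : IsNormal m μ B) (h : ¬ IsNormal m μ A ∨ x B < x A) :
    rank m μ x A < rank m μ x B := by
  classical
  refine card_lt_card ((ssubset_iff_of_subset fun C hC => ?_).2 ⟨A, ?_, ?_⟩)
  · simp only [mem_filter, mem_univ, true_and] at hC ⊢
    exact ⟨hB, hC.2.imp_right fun h' => (h.resolve_left (not_not.2 hC.1)).trans h'⟩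
  · simpa using ⟨hB, h⟩
  · simp only [mem_filter, mem_univ, true_and, lt_irrefl, or_false]; tauto

theorem lev_lt_lev {A B : Fin c} (hA : 0 < x A) (hB : IsNormal m μ B)
    (h : ¬ IsNormal m μ A ∨ x B < x A) : lev m μ x A < lev m μ x B := by
  rw [lev, if_neg hA.not_ge, lev]
  split_ifs
  · exact WithTop.coe_lt_top _
  · exact WithTop.coe_lt_coe.2 (Fin.mk_lt_mk.2 (rank_lt_rank hB h))

theorem lev_le_lev {A B : Fin c} (hA : 0 < x A) (hB : IsNormal m μ B) (h : x B ≤ x A) :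
    lev m μ x A ≤ lev m μ x B := by
  rw [lev, if_neg hA.not_ge, lev]
  split_ifs
  · exact le_top
  · exact WithTop.coe_le_coe.2 (Fin.mk_le_mk.2 (rank_le_rank hB h))

theorem lev_eq_top_iff {A : Fin c} : lev m μ x A = ⊤ ↔ x A ≤ 0 := by
  unfold lev; split_ifs with h <;> simp [h]

theorem lev_lt_lev_iff {A B : Fin c} (hA : IsNormal m μ A) (hB : IsNormal m μ B) (hx : 0 < x A) :
    lev m μ x B < lev m μ x A ↔ x A < x B := by
  refine ⟨fun h => ?_, fun h => lev_lt_lev (hx.trans h) hA (.inr h)⟩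
  by_contra! h'
  exact h.not_ge (lev_le_lev hx hB h')

theorem lev_le_lev_iff {A B : Fin c} (hA : IsNormal m μ A) (hB : IsNormal m μ B) (hx : 0 < x A) :
    lev m μ x B ≤ lev m μ x A ↔ x A ≤ x B := by
  refine ⟨fun h => ?_, fun h => lev_le_lev (hx.trans_le h) hA h⟩
  by_contra! h'
  exact h.not_gt (lev_lt_lev hx hB (.inr h'))

theorem same_pos (hμ : IsDistribution μ) {A : Fin c} (hA : 0 < μ A) : 0 < same μ x A :=
  hA.trans_le (single_le_sum (f := μ) (fun B _ => hμ.1 B) (by simp))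

theorem higher_add_same (μ x : Fin c → ℝ) (A : Fin c) :
    higher μ x A + same μ x A = ∑ B with x A ≤ x B, μ B := by
  rw [higher, same, ← sum_union]
  · congr 1
    ext B
    simp [le_iff_lt_or_eq, eq_comm]
  · rw [disjoint_filter]
    exact fun B _ h h' => h.ne' h'

theorem higher_add_same_le_one (hμ : IsDistribution μ) (A : Fin c) :
    higher μ x A + same μ x A ≤ 1 := by
  rw [higher_add_same, ← hμ.2]
  exact sum_le_sum_of_subset_of_nonneg (filter_subset ..) fun B _ _ => hμ.1 B

theorem higher_add_same_le (hμ : IsDistribution μ) {A B : Fin c} (h : x B < x A) :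
    higher μ x A + same μ x A ≤ higher μ x B := by
  rw [higher_add_same, higher]
  refine sum_le_sum_of_subset_of_nonneg (fun C hC => ?_) fun C _ _ => hμ.1 C
  simp only [mem_filter, mem_univ, true_and] at hC ⊢
  exact h.trans_le hC

/-- For a normal type the formula follows from the tightness of Border's condition for the types on
or above its level and for the types above its level. -/
theorem winProb_lev (hμ : IsDistribution μ) (i : Fin m) (A : Fin c) :
    winProb μ (lev m μ x) i A = val m μ x A := by
  have hm : 1 ≤ m := i.pos
  unfold val
  split_ifs with h0 hA
  · exact winProb_of_eq_top i (lev_eq_top_iff.2 h0)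
  · push Not at h0
    have hA' : lev m μ x A ≠ ⊤ := fun h => h0.not_ge (lev_eq_top_iff.1 h)
    have hN : ∀ B, μ B ≠ 0 → IsNormal m μ B := fun B hB => ⟨hA.1, (hμ.1 B).lt_of_ne' hB⟩
    have key := fun U h h' => border_eq_of_priority (H := lev m μ x) hμ U h h' i
    have h1 := key {B | lev m μ x B ≤ lev m μ x A} (by
        simp only [mem_filter, mem_univ, true_and]
        exact fun B hB => (hB.trans_lt (lt_top_iff_ne_top.2 hA')).ne) (by
        simp only [mem_filter, mem_univ, true_and, not_le]
        exact fun B hB C hC => hB.trans_lt hC)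
    have h2 := key {B | lev m μ x B < lev m μ x A} (by
        simp only [mem_filter, mem_univ, true_and]
        exact fun B hB => (hB.trans (lt_top_iff_ne_top.2 hA')).ne) (by
        simp only [mem_filter, mem_univ, true_and, not_lt]
        exact fun B hB C hC => hB.trans_le hC)
    have e1 : ∑ B with lev m μ x B ≤ lev m μ x A, μ B = higher μ x A + same μ x A := by
      rw [higher_add_same, sum_filter, sum_filter]
      refine sum_congr rfl fun B _ => ?_
      by_cases hB : μ B = 0
      · simp [hB]
      · simp only [lev_le_lev_iff hA (hN B hB) h0]
    have e2 : ∑ B with lev m μ x B < lev m μ x A, μ B = higher μ x A := by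
      rw [higher, sum_filter, sum_filter]
      refine sum_congr rfl fun B _ => ?_
      by_cases hB : μ B = 0
      · simp [hB]
      · simp only [lev_lt_lev_iff hA (hN B hB) h0]
    have e3 : ∑ B with lev m μ x B ≤ lev m μ x A, μ B * winProb μ (lev m μ x) i B =
        ∑ B with lev m μ x B < lev m μ x A, μ B * winProb μ (lev m μ x) i B +
          same μ x A * winProb μ (lev m μ x) i A := by
      rw [same, sum_mul, sum_filter, sum_filter, sum_filter, ← sum_add_distrib]
      refine sum_congr rfl fun B _ => ?_
      by_cases hB : μ B = 0
      · simp [hB]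
      · simp only [lev_le_lev_iff hA (hN B hB) h0, lev_lt_lev_iff hA (hN B hB) h0]
        rcases lt_trichotomy (x A) (x B) with h | h | h
        · simp [h, h.le, h.ne']
        · have : lev m μ x B = lev m μ x A :=
            le_antisymm (lev_le_lev (h0.trans_eq h) hA h.le) (lev_le_lev h0 (hN B hB) h.ge)
          simp [h, winProb_congr hμ i this]
        · simp [h.not_gt, h.not_ge, h.ne]
    rw [e1, e3, mul_add, ] at h1
    rw [e2] at h2
    have hq := same_pos (x := x) hμ hA.2
    have hm0 : (0 : ℝ) < m := by exact_mod_cast hm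
    rw [eq_div_iff (by positivity), sub_sub]
    linarith
  · push Not at h0
    refine winProb_of_top_priority hμ i (fun h => h0.not_ge (lev_eq_top_iff.1 h)) ?_
    by_cases h2 : 2 ≤ m
    · exact .inr fun B hB => lev_lt_lev h0 ⟨h2, hB⟩ (.inl hA)
    · left; omega

theorem val_pos (hμ : IsDistribution μ) {A : Fin c} (hx : 0 < x A) : 0 < val m μ x A := by
  unfold val
  rw [if_neg hx.not_ge]
  split_ifs with hA
  · have hq := same_pos (x := x) hμ hA.2
    have hm0 : (0 : ℝ) < m := by have := hA.1; positivity
    have := higher_add_same_le_one (x := x) hμ A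
    refine div_pos (sub_pos.2 (pow_lt_pow_left₀ (by linarith) (by linarith) ?_)) (by positivity)
    have := hA.1; omega
  · exact one_pos

/-- The interim winning probability is the slope of a chord of the strictly convex function
`s ↦ s ^ m` (divided by `m`), and the chords of different levels are over consecutive intervals. -/
theorem val_lt_val (hμ : IsDistribution μ) (hx : ∀ A, 0 ≤ x A) {A B : Fin c} (hA : IsNormal m μ A)
    (hB : IsNormal m μ B) (h : x B < x A) : val m μ x B < val m μ x A := by
  have hxA : 0 < x A := (hx B).trans_lt h
  rcases (hx B).eq_or_lt' with hB0 | hB0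
  · rw [val, if_pos hB0.le]
    exact val_pos hμ hxA
  rw [val, if_neg hB0.not_ge, if_pos hB, val, if_neg hxA.not_ge, if_pos hA]
  have hqA := same_pos (x := x) hμ hA.2
  have hqB := same_pos (x := x) hμ hB.2
  have hB1 := higher_add_same_le_one (x := x) hμ B
  have hAB := higher_add_same_le hμ h
  have hconv := strictConvexOn_pow (n := m) hA.1
  have hm0 : (0 : ℝ) < m := by have := hA.1; positivity
  set X := 1 - higher μ x A with hX
  set Z := 1 - higher μ x B - same μ x B with hZ
  have key : ((1 - higher μ x B) ^ m - Z ^ m) / ((1 - higher μ x B) - Z) <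
      (X ^ m - (X - same μ x A) ^ m) / (X - (X - same μ x A)) := by
    rcases (show X - same μ x A ≥ 1 - higher μ x B by linarith).eq_or_lt with h' | h'
    · rw [h']
      exact hconv.slope_strict_mono_adjacent (Set.mem_Ici.2 (by linarith))
        (Set.mem_Ici.2 (by linarith)) (by linarith) (by linarith)
    · exact (hconv.slope_strict_mono_adjacent (Set.mem_Ici.2 (by linarith))
        (Set.mem_Ici.2 (by linarith)) (by linarith) h').trans
        (hconv.slope_strict_mono_adjacent (Set.mem_Ici.2 (by linarith))
        (Set.mem_Ici.2 (by linarith)) (by linarith) (by linarith))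
  have e1 : 1 - higher μ x B - Z = same μ x B := by rw [hZ]; ring
  rw [e1, sub_sub_cancel] at key
  rw [mul_comm, ← div_div, mul_comm, ← div_div]
  gcongr

theorem val_congr {A B : Fin c} (hA : IsNormal m μ A) (hB : IsNormal m μ B) (h : x A = x B) :
    val m μ x A = val m μ x B := by
  simp only [val, higher, same, h, hA, hB]

/-- Border's condition is tight in the hierarchical mechanism of `x` for sets of normal types that
have larger values of `x` than all other normal types. -/
theorem border_eq_val (hμ : IsDistribution μ) (S : Finset (Fin c))
    (hS : ∀ A ∈ S, IsNormal m μ A ∧ 0 < x A)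
    (hS' : ∀ A ∈ S, ∀ B ∉ S, IsNormal m μ B → x B < x A) :
    m * ∑ A ∈ S, μ A * val m μ x A = 1 - (1 - ∑ A ∈ S, μ A) ^ m := by
  classical
  rcases S.eq_empty_or_nonempty with rfl | ⟨A₀, hA₀⟩
  · simp
  have hm : 2 ≤ m := (hS A₀ hA₀).1.1
  set U : Finset (Fin c) := S ∪ filter (fun A => ¬ IsNormal m μ A ∧ 0 < x A) univ with hU
  have hmem : ∀ A, A ∈ U ↔ A ∈ S ∨ (¬ IsNormal m μ A ∧ 0 < x A) := by simp [hU]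
  have hzero : ∀ A ∈ U, A ∉ S → μ A = 0 := fun A hA hAS =>
    eq_zero_of_not_isNormal hμ hm (((hmem A).1 hA).resolve_left hAS).1
  have h := border_eq_of_priority (H := lev m μ x) hμ U
    (fun A hA hA' => by
      have := lev_eq_top_iff.1 hA'
      rcases (hmem A).1 hA with h | h
      · exact (hS A h).2.not_ge this
      · exact h.2.not_ge this)
    (fun A hA B hB => by
      have hB' := fun h => hB ((hmem B).2 h)
      have hxA : 0 < x A := by
        rcases (hmem A).1 hA with h | h
        exacts [(hS A h).2, h.2]
      by_cases hBN : IsNormal m μ B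
      · refine lev_lt_lev hxA hBN ?_
        rcases (hmem A).1 hA with h | h
        · exact .inr (hS' A h B (fun h => hB' (.inl h)) hBN)
        · exact .inl h.1
      · have : ¬ 0 < x B := fun h => hB' (.inr ⟨hBN, h⟩)
        rw [lev_eq_top_iff.2 (not_lt.1 this), lt_top_iff_ne_top, ne_eq, lev_eq_top_iff]
        exact hxA.not_ge) (⟨0, by omega⟩ : Fin m)
  simp only [winProb_lev hμ] at h
  have hsub : S ⊆ U := subset_union_left
  rw [← sum_subset hsub fun A hA hAS => hzero A hA hAS,
    ← sum_subset hsub fun A hA hAS => by rw [hzero A hA hAS, zero_mul]] at h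
  exact h

/-! ### Greedy decomposition -/

/-- The remainder `x` can be implemented with the remaining probability `r`: Border's condition,
scaled by `r` and restricted to upper sets of normal types. -/
structure Implementable (m : ℕ) (μ : Fin c → ℝ) (r : ℝ) (x : Fin c → ℝ) : Prop where
  budget_nonneg : 0 ≤ r
  nonneg : ∀ A, 0 ≤ x A
  le_budget : ∀ A, ¬ IsNormal m μ A → x A ≤ r
  border : ∀ S : Finset (Fin c), (∀ A ∈ S, IsNormal m μ A ∧ 0 < x A) →
    (∀ A ∈ S, ∀ B ∉ S, IsNormal m μ B → x B < x A) →
    m * ∑ A ∈ S, μ A * x A ≤ r * (1 - (1 - ∑ A ∈ S, μ A) ^ m)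

/-- The multiples `a` of `val m μ x` for which `x - a * val m μ x` vanishes at another type or takes
the same value at two more normal types. -/
def IsRatio (m : ℕ) (μ x : Fin c → ℝ) (a : ℝ) : Prop :=
  (∃ A, 0 < x A ∧ a = x A / val m μ x A) ∨
  ∃ A B, IsNormal m μ A ∧ IsNormal m μ B ∧ x B < x A ∧
    a = (x A - x B) / (val m μ x A - val m μ x B)

/-- The probability `α` that the greedy algorithm assigns to the hierarchy of `x`: the first value
at which this hierarchy changes, unless the budget `r` is used up earlier. -/
structure IsStep (m : ℕ) (μ : Fin c → ℝ) (r : ℝ) (x : Fin c → ℝ) (α : ℝ) : Prop where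
  le_budget : α ≤ r
  le_ratio : ∀ a, IsRatio m μ x a → α ≤ a
  eq : α = r ∨ IsRatio m μ x α

theorem IsRatio.nonneg (hμ : IsDistribution μ) (hx : ∀ A, 0 ≤ x A) {a : ℝ}
    (h : IsRatio m μ x a) : 0 ≤ a := by
  rcases h with ⟨A, hA, rfl⟩ | ⟨A, B, hA, hB, h, rfl⟩
  · exact div_nonneg hA.le (val_pos hμ hA).le
  · exact div_nonneg (sub_nonneg.2 h.le) (sub_nonneg.2 (val_lt_val hμ hx hA hB h).le)

theorem IsStep.nonneg (hμ : IsDistribution μ) (hI : Implementable m μ r x)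
    (h : IsStep m μ r x α) : 0 ≤ α := by
  rcases h.eq with rfl | h
  exacts [hI.budget_nonneg, h.nonneg hμ hI.nonneg]

theorem val_nonneg (hμ : IsDistribution μ) (A : Fin c) : 0 ≤ val m μ x A := by
  by_cases h : 0 < x A
  · exact (val_pos hμ h).le
  · rw [val, if_pos (not_lt.1 h)]

theorem IsStep.sub_le (hμ : IsDistribution μ) (hI : Implementable m μ r x)
    (h : IsStep m μ r x α) (A : Fin c) : x A - α * val m μ x A ≤ x A :=
  sub_le_self _ (mul_nonneg (h.nonneg hμ hI) (val_nonneg hμ A))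

theorem IsStep.sub_nonneg (hμ : IsDistribution μ) (hI : Implementable m μ r x)
    (h : IsStep m μ r x α) (A : Fin c) : 0 ≤ x A - α * val m μ x A := by
  rcases (hI.nonneg A).eq_or_lt' with hA | hA
  · rw [val, if_pos hA.le]; simp [hA]
  · have := h.le_ratio _ (.inl ⟨A, hA, rfl⟩)
    rw [le_div_iff₀ (val_pos hμ hA)] at this
    linarith

/-- A step does not reverse the order of normal types. -/
theorem IsStep.sub_mono (hμ : IsDistribution μ) (hI : Implementable m μ r x)
    (h : IsStep m μ r x α) {A B : Fin c} (hA : IsNormal m μ A) (hB : IsNormal m μ B)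
    (hAB : x B ≤ x A) : x B - α * val m μ x B ≤ x A - α * val m μ x A := by
  rcases hAB.eq_or_lt with hAB | hAB
  · rw [hAB, val_congr hB hA hAB]
  · have := h.le_ratio _ (.inr ⟨A, B, hA, hB, hAB, rfl⟩)
    rw [le_div_iff₀ (sub_pos.2 (val_lt_val hμ hI.nonneg hA hB hAB))] at this
    linarith

/-- What remains after a step can be implemented with the remaining budget, since Border's
condition is tight for the hierarchy of `x` on the upper sets of `x`. -/
theorem Implementable.step (hμ : IsDistribution μ) (hI : Implementable m μ r x)
    (h : IsStep m μ r x α) : Implementable m μ (r - α) fun A => x A - α * val m μ x A where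
  budget_nonneg := _root_.sub_nonneg.2 h.le_budget
  nonneg := h.sub_nonneg hμ hI
  le_budget A hA := by
    rcases (hI.nonneg A).eq_or_lt' with h0 | h0
    · rw [val, if_pos h0.le, h0]
      simpa using h.le_budget
    · rw [val, if_neg h0.not_ge, if_neg hA]
      simpa using hI.le_budget A hA
  border S hS hS' := by
    have hS₁ : ∀ A ∈ S, IsNormal m μ A ∧ 0 < x A := fun A hA =>
      ⟨(hS A hA).1, (hS A hA).2.trans_le (h.sub_le hμ hI A)⟩
    have hS₂ : ∀ A ∈ S, ∀ B ∉ S, IsNormal m μ B → x B < x A := fun A hA B hB hBN => by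
      by_contra! hle
      exact (hS' A hA B hB hBN).not_ge (h.sub_mono hμ hI hBN (hS A hA).1 hle)
    have h1 := hI.border S hS₁ hS₂
    have h2 := border_eq_val hμ S hS₁ hS₂
    have h3 : ∑ A ∈ S, μ A * (x A - α * val m μ x A) =
        ∑ A ∈ S, μ A * x A - α * ∑ A ∈ S, μ A * val m μ x A := by
      rw [mul_sum, ← sum_sub_distrib]
      exact sum_congr rfl fun A _ => by ring
    rw [h3]
    linear_combination h1 - α * h2

theorem Implementable.eq_zero_of_budget_eq_zero (hI : Implementable m μ 0 x)
    (A : Fin c) : x A = 0 := by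
  classical
  by_cases hA : IsNormal m μ A
  · by_contra hne
    have hpos : 0 < x A := (hI.nonneg A).lt_of_ne' hne
    have h := hI.border {B | IsNormal m μ B ∧ 0 < x B} (by simp) (by
      simp only [mem_filter, mem_univ, true_and, not_and, not_lt]
      exact fun B hB C hC hCN => (hC hCN).trans_lt hB.2)
    rw [zero_mul] at h
    have hm0 : (0 : ℝ) < m := by have := hA.1; positivity
    have h0 : 0 < ∑ B with IsNormal m μ B ∧ 0 < x B, μ B * x B :=
      (mul_pos hA.2 hpos).trans_le (single_le_sum (f := fun B => μ B * x B)
        (fun B hB => by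
          simp only [mem_filter, mem_univ, true_and] at hB
          exact (mul_pos hB.1.2 hB.2).le) (by simp [hA, hpos]))
    exact (mul_pos hm0 h0).not_ge h
  · exact le_antisymm (hI.le_budget A hA) (hI.nonneg A)

open Classical in
/-- The number of steps that the greedy algorithm still needs: the number of positive entries at
types that are not normal, and the number of different positive values at normal types. -/
noncomputable def potential (m : ℕ) (μ x : Fin c → ℝ) : ℕ :=
  #{A | ¬ IsNormal m μ A ∧ 0 < x A} +
    #(image x {A | IsNormal m μ A ∧ 0 < x A})

theorem potential_le (m : ℕ) (μ x : Fin c → ℝ) : potential m μ x ≤ c := by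
  classical
  have h1 : #{A | ¬ IsNormal m μ A ∧ 0 < x A} ≤ #{A | ¬ IsNormal m μ A} :=
    card_le_card fun A => by simp +contextual
  have h2 : #{A | IsNormal m μ A ∧ 0 < x A} ≤ #{A | IsNormal m μ A} :=
    card_le_card fun A => by simp +contextual
  have h3 := card_image_le (f := x) (s := {A | IsNormal m μ A ∧ 0 < x A})
  have h4 := card_filter_add_card_filter_not (s := (univ : Finset (Fin c)))
    fun A => IsNormal m μ A
  rw [card_univ, Fintype.card_fin] at h4
  unfold potential
  omega

theorem potential_eq_zero_iff (hx : ∀ A, 0 ≤ x A) : potential m μ x = 0 ↔ ∀ A, x A = 0 := by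
  classical
  simp only [potential, add_eq_zero, card_eq_zero, image_eq_empty, filter_eq_empty_iff, mem_univ,
    true_implies, not_and, not_lt]
  constructor
  · rintro ⟨h1, h2⟩ A
    by_cases hA : IsNormal m μ A
    exacts [(h2 hA).antisymm (hx A), (h1 hA).antisymm (hx A)]
  · exact fun h => ⟨fun A _ => (h A).le, fun A _ => (h A).le⟩

theorem potential_step (hμ : IsDistribution μ) (hI : Implementable m μ r x)
    (h : IsStep m μ r x α) (hpos : 0 < potential m μ x) :
    potential m μ (fun A => x A - α * val m μ x A) < potential m μ x := by
  classical
  set y : Fin c → ℝ := fun A => x A - α * val m μ x A with hy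
  have hyx : ∀ A, y A ≤ x A := h.sub_le hμ hI
  rcases h.eq with rfl | hα
  · have h0 := hI.step hμ h
    rw [sub_self] at h0
    rwa [(potential_eq_zero_iff h0.nonneg).2 h0.eq_zero_of_budget_eq_zero]
  -- `y` is a function of `x` on normal types
  obtain ⟨f, hf⟩ : ∃ f : ℝ → ℝ, ∀ A, IsNormal m μ A → y A = f (x A) := by
    refine ⟨fun z => if hz : ∃ A, IsNormal m μ A ∧ x A = z then y hz.choose else 0,
      fun A hA => ?_⟩
    have hz : ∃ B, IsNormal m μ B ∧ x B = x A := ⟨A, hA, rfl⟩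
    simp only [dif_pos hz]
    simp only [hy, hz.choose_spec.2, val_congr hz.choose_spec.1 hA hz.choose_spec.2]
  have hsub : ({A | ¬ IsNormal m μ A ∧ 0 < y A} : Finset (Fin c)) ⊆
      filter (fun A => ¬ IsNormal m μ A ∧ 0 < x A) univ := fun A hA => by
    simp only [mem_filter, mem_univ, true_and] at hA ⊢
    exact ⟨hA.1, hA.2.trans_le (hyx A)⟩
  have himg : image y {A | IsNormal m μ A ∧ 0 < y A} ⊆
      image f (image x {A | IsNormal m μ A ∧ 0 < x A}) := fun z hz => by
    simp only [mem_image, mem_filter, mem_univ, true_and] at hz ⊢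
    obtain ⟨A, hA, rfl⟩ := hz
    exact ⟨x A, ⟨A, ⟨hA.1, hA.2.trans_le (hyx A)⟩, rfl⟩, (hf A hA.1).symm⟩
  have hcard := (card_le_card himg).trans card_image_le
  -- at a normal type `A`, the value `x A` is lost by vanishing or by merging with a smaller one
  have hnormal : ∀ A, IsNormal m μ A → 0 < x A →
      (y A = 0 ∨ ∃ B, IsNormal m μ B ∧ x B < x A ∧ y A = y B) →
      potential m μ y < potential m μ x := by
    intro A hA hxA hcase
    have hsub' : image y {A | IsNormal m μ A ∧ 0 < y A} ⊆
        image f ((image x {A | IsNormal m μ A ∧ 0 < x A}).erase (x A)) := fun z hz => by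
      simp only [mem_image, mem_filter, mem_univ, true_and, mem_erase] at hz ⊢
      obtain ⟨C, hC, rfl⟩ := hz
      by_cases hCA : x C = x A
      · have hyCA : y C = y A := by rw [hf C hC.1, hf A hA, hCA]
        rcases hcase with h0 | ⟨B, hB, hBA, hyAB⟩
        · exact absurd hC.2 (by rw [hyCA, h0]; exact lt_irrefl 0)
        · have : 0 < y B := by rw [← hyAB, ← hyCA]; exact hC.2
          exact ⟨x B, ⟨hBA.ne, B, ⟨hB, this.trans_le (hyx B)⟩, rfl⟩,
            by rw [← hf B hB, hyCA, hyAB]⟩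
      · exact ⟨x C, ⟨hCA, C, ⟨hC.1, hC.2.trans_le (hyx C)⟩, rfl⟩, (hf C hC.1).symm⟩
    have h1 := (card_le_card hsub').trans card_image_le
    have h2 : x A ∈ image x {A | IsNormal m μ A ∧ 0 < x A} :=
      mem_image.2 ⟨A, by simp [hA, hxA], rfl⟩
    rw [card_erase_of_mem h2] at h1
    have h3 := card_pos.2 ⟨_, h2⟩
    have h4 := card_le_card hsub
    unfold potential
    omega
  rcases hα with ⟨A, hA, hα⟩ | ⟨A, B, hA, hB, hBA, hα⟩
  · have hyA : y A = 0 := by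
      rw [eq_div_iff (val_pos hμ hA).ne'] at hα
      simp [hy, hα]
    by_cases hAN : IsNormal m μ A
    · exact hnormal A hAN hA (.inl hyA)
    · have : #({A | ¬ IsNormal m μ A ∧ 0 < y A} : Finset (Fin c)) <
          #({A | ¬ IsNormal m μ A ∧ 0 < x A} : Finset (Fin c)) :=
        card_lt_card ((ssubset_iff_of_subset hsub).2 ⟨A, by simp [hAN, hA], by simp [hyA]⟩)
      unfold potential
      omega
  · refine hnormal A hA ((hI.nonneg B).trans_lt hBA) (.inr ⟨B, hB, hBA, ?_⟩)
    rw [eq_div_iff (sub_pos.2 (val_lt_val hμ hI.nonneg hA hB hBA)).ne'] at hα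
    simp only [hy]
    linarith

/-- The greedy algorithm starts from a reduced form that satisfies Border's condition. -/
theorem implementable_one {π : Fin c → ℝ} (hπ : IsReducedForm π)
    (h : ∀ S : Finset (Fin c), (∀ A ∈ S, ∀ B ∉ S, IsNormal m μ B → π B < π A) →
      m * ∑ A ∈ S, μ A * π A ≤ 1 - (1 - ∑ A ∈ S, μ A) ^ m) :
    Implementable m μ 1 π where
  budget_nonneg := zero_le_one
  nonneg A := (hπ A).1
  le_budget A _ := (hπ A).2
  border S _ hS' := by simpa using h S hS'

end Greedy

open RealRAM RealRAM.Code

/-! ### The program for the greedy decomposition -/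

/-- Raises real register `b` to the power `m`, which is stored in integer register `1`; the result
is in real register `z`. -/
def powCode (z b i : ℕ) : Code :=
  .rset z (.ofInt (.lit 1)) ;; .rep i 1 (.rset z (.mul (.reg z) (.reg b)))

theorem run_powCode {z b i : ℕ} (hzb : b ≠ z) (s : Store) :
    ((powCode z b i).run s).rreg z = s.rreg b ^ s.ireg 1 := by
  have h := rep_induction i 1 (.rset z (.mul (.reg z) (.reg b))) (s.rset z 1)
    (fun n s' => s'.rreg z = s.rreg b ^ n ∧ s'.rreg b = s.rreg b) (by simp [hzb]) (by
      intro n hn s' _ hF hs'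
      simp [Code.run, RExp.eval, hs', pow_succ, hzb])
  simpa [powCode, Code.run, RExp.eval, IExp.eval] using h.1

/-- The test whether the type in integer register `y` is normal. -/
def normalTest (y : ℕ) : Test :=
  .conj (.ile (.lit 2) (.reg 1)) (.rlt (.ofInt (.lit 0)) (.get 0 (.reg y)))

/-- The memory holds the numbers of types and bidders, the type distribution (array `0`) and the
remainder of the reduced form (array `3`). -/
structure Ready {c : ℕ} (m : ℕ) (μ x : Fin c → ℝ) (s : Store) : Prop where
  types : s.ireg 0 = c
  bidders : s.ireg 1 = m
  dist : ∀ A : Fin c, s.rarr 0 A = μ A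
  rest : ∀ A : Fin c, s.rarr 3 A = x A

theorem Ready.frame {c m : ℕ} {μ x : Fin c → ℝ} {s s' : Store} {p : Code} (hs : Ready m μ x s)
    (hF : p.Frame s' s) (h0 : p.writes (.ireg 0) = false) (h1 : p.writes (.ireg 1) = false)
    (h2 : p.writes (.rarr 0) = false) (h3 : p.writes (.rarr 3) = false) : Ready m μ x s' where
  types := (hF.ireg 0 h0).trans hs.types
  bidders := (hF.ireg 1 h1).trans hs.bidders
  dist A := by rw [hF.rarr 0 h2, hs.dist]
  rest A := by rw [hF.rarr 3 h3, hs.rest]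

section Programs

variable {c m : ℕ} {μ x : Fin c → ℝ} {s : Store}

theorem Ready.holds_normalTest (hs : Ready m μ x s) {y : ℕ} (A : Fin c) (hA : s.ireg y = A) :
    (normalTest y).Holds s ↔ IsNormal m μ A := by
  simp [normalTest, IsNormal, RExp.eval, IExp.eval, hA, hs.bidders, hs.dist]

/-- The first `i` types. -/
def below (c i : ℕ) : Finset (Fin c) := univ.filter fun B => (B : ℕ) < i

theorem mem_below {i : ℕ} {B : Fin c} : B ∈ below c i ↔ (B : ℕ) < i := by simp [below]

@[simp] theorem below_zero : below c 0 = ∅ := by simp [below]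

@[simp] theorem below_self : below c c = univ := by simp [below]

theorem below_succ {i : ℕ} (hi : i < c) : below c (i + 1) = insert ⟨i, hi⟩ (below c i) := by
  ext B
  simp only [mem_below, mem_insert, Fin.ext_iff]
  omega

theorem sum_below_succ {M : Type*} [AddCommMonoid M] {i : ℕ} (hi : i < c) (f : Fin c → M) :
    ∑ B ∈ below c (i + 1), f B = ∑ B ∈ below c i, f B + f ⟨i, hi⟩ := by
  rw [below_succ hi, sum_insert (by simp [mem_below]), add_comm]

/-- One round of `tallyCode`: compares the type in integer register `12` with the one in `11`. -/
def tallyStep : Code :=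
  .cond (.rlt (.get 3 (.reg 11)) (.get 3 (.reg 12)))
    (.rset 2 (.add (.reg 2) (.get 0 (.reg 12)))) .skip ;;
  .cond (.conj (.rle (.get 3 (.reg 12)) (.get 3 (.reg 11)))
      (.rle (.get 3 (.reg 11)) (.get 3 (.reg 12))))
    (.rset 3 (.add (.reg 3) (.get 0 (.reg 12)))) .skip ;;
  .cond (.conj (normalTest 11) (.disj (.neg (normalTest 12))
      (.rlt (.get 3 (.reg 11)) (.get 3 (.reg 12)))))
    (.iset 3 (.add (.reg 3) (.lit 1))) .skip

/-- For the type in integer register `11`, the probabilities of larger and of equal types go to the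
real registers `2` and `3`, and its rank to integer register `3`. -/
def tallyCode : Code :=
  .rset 2 (.ofInt (.lit 0)) ;; .rset 3 (.ofInt (.lit 0)) ;; .iset 3 (.lit 0) ;;
  .rep 12 0 tallyStep

open Classical in
theorem run_tallyCode (hs : Ready m μ x s) (A : Fin c) (hA : s.ireg 11 = A) :
    (tallyCode.run s).rreg 2 = higher μ x A ∧ (tallyCode.run s).rreg 3 = same μ x A ∧
      (tallyCode.run s).ireg 3 = rank m μ x A := by
  set s₀ := ((s.rset 2 0).rset 3 0).iset 3 0 with hs₀
  have h := rep_induction 12 0 tallyStep s₀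
    (fun i s' =>
      s'.rreg 2 = ∑ B ∈ below c i, (if x A < x B then μ B else 0) ∧
      s'.rreg 3 = ∑ B ∈ below c i, (if x B = x A then μ B else 0) ∧
      s'.ireg 3 = ∑ B ∈ below c i,
        if IsNormal m μ A ∧ (¬ IsNormal m μ B ∨ x A < x B) then 1 else 0)
    (by simp [hs₀]) (by
      rintro i hi s' hi' hF ⟨h2, h3, h4⟩
      have hs0 : Ready m μ x s₀ := ⟨hs.1, hs.2, hs.3, hs.4⟩
      have hs' := hs0.frame hF rfl rfl rfl rfl
      have hA' : s'.ireg 11 = A := (hF.ireg 11 rfl).trans hA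
      have hic : i < c := by simpa [hs0.types] using hi
      have e1 := hs'.rest A
      have e2 := hs'.rest ⟨i, hic⟩
      have e3 := hs'.dist A
      have e4 := hs'.dist ⟨i, hic⟩
      have e5 := hs'.bidders
      simp only at e2 e4
      simp only [sum_below_succ hic, ← h2, ← h3, ← h4]
      simp [tallyStep, Code.run, RExp.eval, IExp.eval, normalTest, IsNormal, hi', hA', e1, e2, e3,
        e4, e5, ← le_antisymm_iff]
      refine ⟨by split_ifs <;> simp, by split_ifs <;> simp, ?_⟩
      split_ifs <;> rfl )
  have hc : s₀.ireg 0 = c := by simpa [hs₀] using hs.types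
  rw [hc, below_self] at h
  simp only [higher, same, rank, sum_filter, card_filter]
  convert h using 0
  simp [hs₀, tallyCode, Code.run, RExp.eval, IExp.eval]

/-- The powers from which the interim winning probability of a normal type is computed. -/
def powersCode : Code :=
  .rset 6 (.sub (.ofInt (.lit 1)) (.reg 2)) ;; powCode 4 6 13 ;;
  .rset 6 (.sub (.reg 6) (.reg 3)) ;; powCode 5 6 13

theorem run_powersCode (s : Store) :
    (powersCode.run s).rreg 4 = (1 - s.rreg 2) ^ s.ireg 1 ∧
    (powersCode.run s).rreg 5 = (1 - s.rreg 2 - s.rreg 3) ^ s.ireg 1 := by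
  simp only [powersCode, Code.run]
  set s₁ := s.rset 6 (RExp.eval s (.sub (.ofInt (.lit 1)) (.reg 2))) with hs₁
  have e₁ := run_powCode (z := 4) (b := 6) (i := 13) (by simp) s₁
  have hF₁ := frame_run (powCode 4 6 13) s₁
  set s₂ := (powCode 4 6 13).run s₁
  set s₃ := s₂.rset 6 (RExp.eval s₂ (.sub (.reg 6) (.reg 3))) with hs₃
  have e₃ := run_powCode (z := 5) (b := 6) (i := 13) (by simp) s₃
  have hF₃ := frame_run (powCode 5 6 13) s₃
  rw [hF₃.rreg 4 rfl, e₃]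
  simp [hs₃, e₁, hs₁, RExp.eval, IExp.eval, hF₁.rreg 6 rfl, hF₁.rreg 3 rfl, hF₁.ireg 1 rfl]

/-- For the type in integer register `11`, the entry of `val` goes to array `4`, and the level to
the table (integer array `0`) at the position given by integer register `4`. -/
def valueCode : Code :=
  tallyCode ;; powersCode ;;
  .cond (.rle (.get 3 (.reg 11)) (.ofInt (.lit 0)))
    (.rput 4 (.reg 11) (.ofInt (.lit 0)) ;; .iput 0 (.add (.reg 4) (.reg 11)) (.reg 0))
    (.iput 0 (.add (.reg 4) (.reg 11)) (.reg 3) ;;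
      .cond (normalTest 11)
        (.rput 4 (.reg 11) (.div (.sub (.reg 4) (.reg 5)) (.mul (.ofInt (.reg 1)) (.reg 3))))
        (.rput 4 (.reg 11) (.ofInt (.lit 1))))

theorem encodeLevel_lev (A : Fin c) :
    encodeLevel (lev m μ x A) = if x A ≤ 0 then c else rank m μ x A := by
  unfold lev; split_ifs <;> rfl

theorem run_valueCode (hs : Ready m μ x s) (A : Fin c) (hA : s.ireg 11 = A) :
    (∀ j, (valueCode.run s).rarr 4 j = if j = A then val m μ x A else s.rarr 4 j) ∧
    ∀ j, (valueCode.run s).iarr 0 j =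
      if j = s.ireg 4 + A then encodeLevel (lev m μ x A) else s.iarr 0 j := by
  obtain ⟨h1, h2, h3⟩ := run_tallyCode hs A hA
  simp only [valueCode, Code.run]
  have hF₁ := frame_run tallyCode s
  set s₁ := tallyCode.run s
  have hs₁ := hs.frame hF₁ rfl rfl rfl rfl
  obtain ⟨r4, r5⟩ := run_powersCode s₁
  have hF₂ := frame_run powersCode s₁
  set s₂ := powersCode.run s₁
  have hs₂ := hs₁.frame hF₂ rfl rfl rfl rfl
  rw [h1, hs₁.bidders] at r4 r5
  rw [h2] at r5
  have r3 : s₂.rreg 3 = same μ x A := by rw [hF₂.rreg 3 rfl, h2]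
  have i3 : s₂.ireg 3 = rank m μ x A := by rw [hF₂.ireg 3 rfl, h3]
  have i4 : s₂.ireg 4 = s.ireg 4 := by rw [hF₂.ireg 4 rfl, hF₁.ireg 4 rfl]
  have i11 : s₂.ireg 11 = A := by rw [hF₂.ireg 11 rfl, hF₁.ireg 11 rfl, hA]
  have a4 : s₂.rarr 4 = s.rarr 4 := by rw [hF₂.rarr 4 rfl, hF₁.rarr 4 rfl]
  have a0 : s₂.iarr 0 = s.iarr 0 := by rw [hF₂.iarr 0 rfl, hF₁.iarr 0 rfl]
  simp only [encodeLevel_lev, val]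
  have hx := hs₂.rest A
  have hd := hs₂.dist A
  constructor <;> intro j <;>
    by_cases h0 : x A ≤ 0 <;> by_cases hN : 2 ≤ m ∧ 0 < μ A <;>
    simp [normalTest, IsNormal, RExp.eval, IExp.eval, i11, i3, i4, a4, a0, r4, r5, r3, hx, hd,
      hs₂.bidders, hs₂.types, h0, hN]

/-- The values and the levels of the hierarchy of the remainder, for all types. -/
def valuesCode : Code := .rep 11 0 valueCode

theorem run_valuesCode (hs : Ready m μ x s) :
    (∀ A : Fin c, (valuesCode.run s).rarr 4 A = val m μ x A) ∧
    (∀ A : Fin c, (valuesCode.run s).iarr 0 (s.ireg 4 + A) = encodeLevel (lev m μ x A)) ∧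
    ∀ j < s.ireg 4, (valuesCode.run s).iarr 0 j = s.iarr 0 j := by
  have h := rep_induction 11 0 valueCode s (fun i s' =>
    (∀ A : Fin c, (A : ℕ) < i → s'.rarr 4 A = val m μ x A) ∧
    (∀ A : Fin c, (A : ℕ) < i → s'.iarr 0 (s.ireg 4 + A) = encodeLevel (lev m μ x A)) ∧
    ∀ j < s.ireg 4, s'.iarr 0 j = s.iarr 0 j) (by simp) (by
      rintro i hi s' hi' hF ⟨h1, h2, h3⟩
      have hic : i < c := by simpa [hs.types] using hi
      have hs' := hs.frame hF rfl rfl rfl rfl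
      obtain ⟨e1, e2⟩ := run_valueCode hs' ⟨i, hic⟩ hi'
      have e3 := hF.ireg 4 rfl
      simp only [Store.iset_rarr, Store.iset_iarr, e1, e2, e3]
      refine ⟨fun A hA => ?_, fun A hA => ?_, fun j hj => ?_⟩
      · by_cases hAi : (A : ℕ) = i
        · obtain rfl : A = ⟨i, hic⟩ := Fin.ext hAi
          simp
        · rw [if_neg hAi, h1 A (by omega)]
      · by_cases hAi : (A : ℕ) = i
        · obtain rfl : A = ⟨i, hic⟩ := Fin.ext hAi
          simp
        · rw [if_neg (by omega), h2 A (by omega)]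
      · rw [if_neg (by omega), h3 j hj])
  rw [hs.types] at h
  exact ⟨fun A => h.1 A A.2, fun A => h.2.1 A A.2, h.2.2⟩

/-- Replaces real register `7` by the value of `e` if the test `b` holds and this value is not
larger. -/
def minCode (b : Test) (e : RExp) : Code := .cond (.conj b (.rle e (.reg 7))) (.rset 7 e) .skip

theorem run_minCode {b : Test} {e : RExp} {s : Store} {P : Prop} [Decidable P] {a : ℝ}
    (hb : b.Holds s ↔ P) (he : e.eval s = a) :
    ((minCode b e).run s).rreg 7 = if P then min (s.rreg 7) a else s.rreg 7 := by
  by_cases h : P <;> by_cases h' : a ≤ s.rreg 7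
  · simp [minCode, Code.run, RExp.eval, hb, he, h, h']
  · simp [minCode, Code.run, RExp.eval, hb, he, h, h', (not_le.1 h').le]
  all_goals simp [minCode, Code.run, hb, h]

/-- The ratio at which the type in integer register `11` vanishes. -/
def vanishCode : Code :=
  minCode (.rlt (.ofInt (.lit 0)) (.get 3 (.reg 11))) (.div (.get 3 (.reg 11)) (.get 4 (.reg 11)))

/-- The ratio at which the types in the integer registers `11` and `12` merge. -/
def mergeCode : Code :=
  minCode (.conj (normalTest 11) (.conj (normalTest 12)
      (.rlt (.get 3 (.reg 12)) (.get 3 (.reg 11)))))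
    (.div (.sub (.get 3 (.reg 11)) (.get 3 (.reg 12)))
      (.sub (.get 4 (.reg 11)) (.get 4 (.reg 12))))

/-- Computes the length of the greedy step from the budget in real register `1`. -/
def stepCode : Code := .rset 7 (.reg 1) ;; .rep 11 0 (vanishCode ;; .rep 12 0 mergeCode)

open Classical in
theorem run_stepCode (hs : Ready m μ x s) (hv : ∀ A : Fin c, s.rarr 4 A = val m μ x A) :
    IsStep m μ (s.rreg 1) x ((stepCode.run s).rreg 7) := by
  -- after some rounds: the minimum of the budget and the ratios found so far
  let Found (P : Fin c → Prop) (Q : Fin c → Fin c → Prop) (a : ℝ) : Prop :=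
    a ≤ s.rreg 1 ∧ (a = s.rreg 1 ∨ IsRatio m μ x a) ∧
    (∀ A, P A → 0 < x A → a ≤ x A / val m μ x A) ∧
    ∀ A B, Q A B → IsNormal m μ A → IsNormal m μ B → x B < x A →
      a ≤ (x A - x B) / (val m μ x A - val m μ x B)
  have hs₀ : Ready m μ x (s.rset 7 (s.rreg 1)) := ⟨hs.1, hs.2, hs.3, hs.4⟩
  have h := rep_induction 11 0 (vanishCode ;; .rep 12 0 mergeCode) (s.rset 7 (s.rreg 1))
    (fun i s' => Found (fun A => A < i) (fun A _ => A < i) (s'.rreg 7))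
    ⟨by simp, by simp, by simp, by simp⟩ (by
      rintro i hi s' hi' hF h
      have hic : i < c := by simpa [hs₀.types] using hi
      have hs' := hs₀.frame hF rfl rfl rfl rfl
      have hv' : ∀ A : Fin c, s'.rarr 4 A = val m μ x A := fun A => by
        rw [hF.rarr 4 rfl]; exact hv A
      have e1 := hs'.rest ⟨i, hic⟩
      have e2 := hv' ⟨i, hic⟩
      simp only at e1 e2
      have hvan : Found (fun A => A < i + 1) (fun A _ => A < i) ((vanishCode.run s').rreg 7) := by
        rw [vanishCode, run_minCode (P := 0 < x ⟨i, hic⟩)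
          (a := x ⟨i, hic⟩ / val m μ x ⟨i, hic⟩)
          (by simp [RExp.eval, IExp.eval, hi', e1]) (by simp [RExp.eval, IExp.eval, hi', e1, e2])]
        obtain ⟨h1, h2, h3, h4⟩ := h
        split_ifs with h0
        · refine ⟨min_le_of_left_le h1, ?_, fun A hA hxA => ?_,
            fun A B hA hAN hBN hAB => min_le_of_left_le (h4 A B hA hAN hBN hAB)⟩
          · rcases min_choice (s'.rreg 7) (x ⟨i, hic⟩ / val m μ x ⟨i, hic⟩) with h | h <;> rw [h]
            · exact h2
            · exact .inr (.inl ⟨_, h0, rfl⟩)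
          · rcases Nat.lt_succ_iff_lt_or_eq.1 hA with hA | hA
            · exact min_le_of_left_le (h3 A hA hxA)
            · obtain rfl : A = ⟨i, hic⟩ := Fin.ext hA
              exact min_le_right _ _
        · refine ⟨h1, h2, fun A hA hxA => ?_, h4⟩
          rcases Nat.lt_succ_iff_lt_or_eq.1 hA with hA | hA
          · exact h3 A hA hxA
          · obtain rfl : A = ⟨i, hic⟩ := Fin.ext hA
            exact absurd hxA h0
      have hF₁ := frame_run vanishCode s'
      simp only [Code.run] at *
      set s₁ := vanishCode.run s' with hs₁
      have hr₁ := hs'.frame hF₁ rfl rfl rfl rfl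
      have hk := rep_induction 12 0 mergeCode s₁ (fun j s'' => Found (fun A => A < i + 1)
          (fun A B => A < i ∨ (A : ℕ) = i ∧ B < j) (s''.rreg 7)) (by simpa using hvan) (by
        rintro j hj s'' hj' hF' ⟨h1, h2, h3, h4⟩
        have hjc : j < c := by simpa [hr₁.types] using hj
        have hr' := hr₁.frame hF' rfl rfl rfl rfl
        have hv'' : ∀ A : Fin c, s''.rarr 4 A = val m μ x A := fun A => by
          rw [hF'.rarr 4 rfl, hF₁.rarr 4 rfl, hv']
        have hi'' : s''.ireg 11 = i := by rw [hF'.ireg 11 rfl, hF₁.ireg 11 rfl, hi']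
        have e1 := hr'.rest ⟨i, hic⟩
        have e2 := hv'' ⟨i, hic⟩
        have e3 := hr'.rest ⟨j, hjc⟩
        have e4 := hv'' ⟨j, hjc⟩
        simp only at e1 e2 e3 e4
        simp only [Store.iset_rreg]
        rw [mergeCode, run_minCode (P := IsNormal m μ ⟨i, hic⟩ ∧ IsNormal m μ ⟨j, hjc⟩ ∧
            x ⟨j, hjc⟩ < x ⟨i, hic⟩) (a := (x ⟨i, hic⟩ - x ⟨j, hjc⟩) /
            (val m μ x ⟨i, hic⟩ - val m μ x ⟨j, hjc⟩))
          (by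
            rw [Test.holds_conj, Test.holds_conj, hr'.holds_normalTest ⟨i, hic⟩ hi'',
              hr'.holds_normalTest ⟨j, hjc⟩ hj']
            simp [RExp.eval, IExp.eval, hi'', hj', e1, e3])
          (by simp [RExp.eval, IExp.eval, hi'', hj', e1, e2, e3, e4])]
        split_ifs with h0
        · refine ⟨min_le_of_left_le h1, ?_, fun A hA hxA => min_le_of_left_le (h3 A hA hxA),
            fun A B hAB hAN hBN hlt => ?_⟩
          · rcases min_choice (s''.rreg 7) ((x ⟨i, hic⟩ - x ⟨j, hjc⟩) /
              (val m μ x ⟨i, hic⟩ - val m μ x ⟨j, hjc⟩)) with h | h <;> rw [h]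
            · exact h2
            · exact .inr (.inr ⟨_, _, h0.1, h0.2.1, h0.2.2, rfl⟩)
          · by_cases hB : (A : ℕ) = i ∧ (B : ℕ) = j
            · obtain rfl : A = ⟨i, hic⟩ := Fin.ext hB.1
              obtain rfl : B = ⟨j, hjc⟩ := Fin.ext hB.2
              exact min_le_right _ _
            · exact min_le_of_left_le (h4 A B (by omega) hAN hBN hlt)
        · refine ⟨h1, h2, h3, fun A B hAB hAN hBN hlt => ?_⟩
          by_cases hB : (A : ℕ) = i ∧ (B : ℕ) = j
          · obtain rfl : A = ⟨i, hic⟩ := Fin.ext hB.1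
            obtain rfl : B = ⟨j, hjc⟩ := Fin.ext hB.2
            exact absurd ⟨hAN, hBN, hlt⟩ h0
          · exact h4 A B (by omega) hAN hBN hlt)
      rw [hr₁.types] at hk
      obtain ⟨h1, h2, h3, h4⟩ := hk
      exact ⟨h1, h2, h3, fun A B hA => h4 A B (by have := B.2; omega)⟩)
  obtain ⟨h1, h2, h3, h4⟩ := h
  have hc : (s.rset 7 (s.rreg 1)).ireg 0 = c := hs.types
  rw [hc] at h3 h4
  refine ⟨h1, ?_, h2⟩
  rintro a (⟨A, hA, rfl⟩ | ⟨A, B, hA, hB, hAB, rfl⟩)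
  · exact h3 A A.2 hA
  · exact h4 A B A.2 hA hB hAB

/-- Subtracts the part of the reduced form that the current hierarchy implements. -/
def subtractCode : Code :=
  .rep 11 0 (.rput 3 (.reg 11) (.sub (.get 3 (.reg 11)) (.mul (.reg 7) (.get 4 (.reg 11)))))

theorem run_subtractCode (hs : Ready m μ x s) (A : Fin c) :
    (subtractCode.run s).rarr 3 A = x A - s.rreg 7 * s.rarr 4 A := by
  have h := rep_induction 11 0
    (.rput 3 (.reg 11) (.sub (.get 3 (.reg 11)) (.mul (.reg 7) (.get 4 (.reg 11))))) s
    (fun i s' => ∀ A : Fin c, s'.rarr 3 A =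
      if A < i then x A - s.rreg 7 * s.rarr 4 A else x A) (by simpa using hs.rest) (by
      rintro i hi s' hi' hF h A
      have e1 := hF.rreg 7 rfl
      have e2 := hF.rarr 4 rfl
      by_cases hA : (A : ℕ) = i
      · have := h A
        rw [hA, if_neg (lt_irrefl _)] at this
        simp [Code.run, RExp.eval, IExp.eval, hi', e1, e2, hA, this]
      · have : (A : ℕ) < i + 1 ↔ (A : ℕ) < i := by omega
        simp [Code.run, RExp.eval, IExp.eval, hi', hA, this, h A])
  rw [hs.types] at h
  simpa [subtractCode] using h A

/-- One step of the greedy algorithm.  Real register `1` holds the budget and real register `7` the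
length of the step; integer register `2` holds the number of hierarchies found so far, integer
register `4` the position of the next one in their table, and real array `2` their probabilities. -/
def roundCode : Code :=
  valuesCode ;; stepCode ;; subtractCode ;; .rput 2 (.reg 2) (.reg 7) ;;
  .rset 1 (.sub (.reg 1) (.reg 7)) ;; .iset 4 (.add (.reg 4) (.reg 0)) ;;
  .iset 2 (.add (.reg 2) (.lit 1))

theorem run_roundCode (hs : Ready m μ x s) : ∃ α, IsStep m μ (s.rreg 1) x α ∧
    Ready m μ (fun A => x A - α * val m μ x A) (roundCode.run s) ∧
    (roundCode.run s).rreg 1 = s.rreg 1 - α ∧ (roundCode.run s).ireg 2 = s.ireg 2 + 1 ∧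
    (roundCode.run s).ireg 4 = s.ireg 4 + c ∧
    (∀ j, (roundCode.run s).rarr 2 j = if j = s.ireg 2 then α else s.rarr 2 j) ∧
    (∀ A : Fin c, (roundCode.run s).iarr 0 (s.ireg 4 + A) = encodeLevel (lev m μ x A)) ∧
    ∀ j < s.ireg 4, (roundCode.run s).iarr 0 j = s.iarr 0 j := by
  obtain ⟨h1, h2, h3⟩ := run_valuesCode hs
  have hF₁ := frame_run valuesCode s
  simp only [roundCode, Code.run]
  set s₁ := valuesCode.run s
  have hs₁ := hs.frame hF₁ rfl rfl rfl rfl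
  have h4 := run_stepCode hs₁ h1
  have hF₂ := frame_run stepCode s₁
  set s₂ := stepCode.run s₁
  have hs₂ := hs₁.frame hF₂ rfl rfl rfl rfl
  have h5 := run_subtractCode hs₂
  have hF₃ := frame_run subtractCode s₂
  set s₃ := subtractCode.run s₂
  rw [hF₁.rreg 1 rfl] at h4
  have r7 := hF₃.rreg 7 rfl
  have r1 : s₃.rreg 1 = s.rreg 1 := by rw [hF₃.rreg 1 rfl, hF₂.rreg 1 rfl, hF₁.rreg 1 rfl]
  have i0 : s₃.ireg 0 = c := by rw [hF₃.ireg 0 rfl, hs₂.types]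
  have i1 : s₃.ireg 1 = m := by rw [hF₃.ireg 1 rfl, hs₂.bidders]
  have i2 : s₃.ireg 2 = s.ireg 2 := by rw [hF₃.ireg 2 rfl, hF₂.ireg 2 rfl, hF₁.ireg 2 rfl]
  have i4 : s₃.ireg 4 = s.ireg 4 := by rw [hF₃.ireg 4 rfl, hF₂.ireg 4 rfl, hF₁.ireg 4 rfl]
  have a2 : s₃.rarr 2 = s.rarr 2 := by rw [hF₃.rarr 2 rfl, hF₂.rarr 2 rfl, hF₁.rarr 2 rfl]
  have a0 : s₃.iarr 0 = s₁.iarr 0 := by rw [hF₃.iarr 0 rfl, hF₂.iarr 0 rfl]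
  refine ⟨s₂.rreg 7, h4, ⟨by simp [i0], by simp [i1], fun A => ?_, fun A => ?_⟩, ?_, ?_, ?_, ?_,
    ?_, ?_⟩
  · simpa [hF₃.rarr 0 rfl] using hs₂.dist A
  · simp [h5, hF₂.rarr 4 rfl, h1]
  · simp [RExp.eval, r1, r7]
  · simp [IExp.eval, i2]
  · simp [IExp.eval, i4, i0]
  · intro j; simp [IExp.eval, RExp.eval, i2, r7, a2]
  · intro A; simp [a0, h2]
  · intro j hj; simpa [a0] using h3 j hj

end Programs

section Decompose

variable {c m k : ℕ} {μ x π : Fin c → ℝ} {s : Store}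

/-- The greedy decomposition of the reduced form in array `1`: every round removes at least one
value, so that nothing is left after `c` rounds, and the last round uses up the budget. -/
def decomposeCode : Code :=
  .rep 11 0 (.rput 3 (.reg 11) (.get 1 (.reg 11))) ;;
  .rset 1 (.ofInt (.lit 1)) ;; .iset 4 (.lit 0) ;; .iset 2 (.lit 0) ;;
  .rep 10 0 roundCode ;; roundCode

/-- The state of the greedy decomposition after `k` rounds, when `x` remains of the reduced form. -/
structure Progress (m : ℕ) (μ π : Fin c → ℝ) (k : ℕ) (x : Fin c → ℝ) (s : Store) : Prop where
  ready : Ready m μ x s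
  implementable : Implementable m μ (s.rreg 1) x
  potential_le : potential m μ x ≤ c - k
  size : s.ireg 2 = k
  offset : s.ireg 4 = k * c
  prob_nonneg : ∀ j < k, 0 ≤ s.rarr 2 j
  prob_sum : ∑ j ∈ range k, s.rarr 2 j + s.rreg 1 = 1
  hierarchies : ∃ H : ℕ → Fin c → Level c,
    (∀ j < k, ∀ A : Fin c, s.iarr 0 (j * c + A) = encodeLevel (H j A)) ∧
    ∀ (i : Fin m) (A : Fin c), ∑ j ∈ range k, s.rarr 2 j * winProb μ (H j) i A + x A = π A

theorem Progress.round (hμ : IsDistribution μ) (h : Progress m μ π k x s) :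
    ∃ α, IsStep m μ (s.rreg 1) x α ∧ (roundCode.run s).rreg 1 = s.rreg 1 - α ∧
      Progress m μ π (k + 1) (fun A => x A - α * val m μ x A) (roundCode.run s) := by
  obtain ⟨α, hα, hready, hr, hsize, hoff, hprob, hlev, htab⟩ := run_roundCode h.ready
  rw [h.size] at hsize hprob
  rw [h.offset] at hoff hlev htab
  have hold : ∀ j < k, (roundCode.run s).rarr 2 j = s.rarr 2 j := fun j hj => by
    rw [hprob, if_neg hj.ne]
  have hnew : (roundCode.run s).rarr 2 k = α := by rw [hprob, if_pos rfl]
  refine ⟨α, hα, hr, hready, ?_, ?_, hsize, ?_, ?_, ?_, ?_⟩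
  · rw [hr]; exact h.implementable.step hμ hα
  · rcases Nat.eq_zero_or_pos (potential m μ x) with h0 | h0
    · have hx := (potential_eq_zero_iff h.implementable.nonneg).1 h0
      rw [(potential_eq_zero_iff (h.implementable.step hμ hα).nonneg).2]
      · exact Nat.zero_le _
      · intro A
        simp [hx A, val]
    · have := potential_step hμ h.implementable hα h0
      have := h.potential_le
      omega
  · rw [hoff]; ring
  · intro j hj
    rcases Nat.lt_succ_iff_lt_or_eq.1 hj with hj | rfl
    · rw [hold j hj]; exact h.prob_nonneg j hj
    · rw [hnew]; exact hα.nonneg hμ h.implementable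
  · rw [sum_range_succ, hnew, hr, sum_congr rfl fun j hj => hold j (mem_range.1 hj)]
    linarith [h.prob_sum]
  · obtain ⟨H, hH, hsum⟩ := h.hierarchies
    have hupd : ∀ j < k, Function.update H k (lev m μ x) j = H j := fun j hj =>
      Function.update_of_ne hj.ne ..
    refine ⟨Function.update H k (lev m μ x), fun j hj A => ?_, fun i A => ?_⟩
    · rcases Nat.lt_succ_iff_lt_or_eq.1 hj with hj | rfl
      · rw [hupd j hj, ← hH j hj]
        refine htab _ ?_
        have := A.2
        nlinarith
      · simp only [Function.update_self]; exact hlev A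
    · rw [sum_range_succ, hnew, ← hsum i A, Function.update_self, winProb_lev hμ,
        sum_congr rfl fun j hj => by rw [hold j (mem_range.1 hj), hupd j (mem_range.1 hj)]]
      ring

theorem interim_mechanism (D : Description c) (i : Fin m) (A : Fin c) :
    interim μ (D.mechanism m).alloc i A = ∑ k, D.prob k * winProb μ (D.level k) i A := by
  simp only [interim, winProb, Description.mechanism, mul_sum]
  rw [sum_comm]
  refine sum_congr rfl fun t _ => ?_
  split_ifs
  · exact sum_congr rfl fun k _ => by ring
  · simp

theorem run_decomposeCode (hμ : IsDistribution μ) (hI : Implementable m μ 1 π)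
    (hs : HoldsInstance s m μ π) : ∃ D : Description c,
      HoldsDescription (decomposeCode.run s) D ∧ ExactlyImplements μ (D.mechanism m) π := by
  obtain ⟨hc, hm, hdist, hform⟩ := hs
  have hcopy := rep_induction 11 0 (.rput 3 (.reg 11) (.get 1 (.reg 11))) s
    (fun i s' => ∀ A : Fin c, A < i → s'.rarr 3 A = π A) (by simp) (by
      intro i hi s' hi' hF h A hA
      have e1 := hF.rarr 1 rfl
      by_cases hAi : (A : ℕ) = i
      · simp [Code.run, RExp.eval, IExp.eval, hi', hAi, e1, ← hform]
      · simpa [Code.run, RExp.eval, IExp.eval, hi', hAi] using h A (by omega))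
  rw [hc] at hcopy
  have hF₁ := frame_run (.rep 11 0 (.rput 3 (.reg 11) (.get 1 (.reg 11)))) s
  have hrun : decomposeCode.run s = roundCode.run ((Code.rep 10 0 roundCode).run
      ((((Code.rep 11 0 (.rput 3 (.reg 11) (.get 1 (.reg 11)))).run s).rset 1 1).iset 4 0
        |>.iset 2 0)) := by
    simp [decomposeCode, Code.run, RExp.eval, IExp.eval]
  rw [hrun]
  clear hrun
  set s₁ := (Code.rep 11 0 (.rput 3 (.reg 11) (.get 1 (.reg 11)))).run s
  set s₂ := ((s₁.rset 1 1).iset 4 0).iset 2 0 with hs₂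
  have hstart : Progress m μ π 0 π (s₂.iset 10 0) :=
    ⟨⟨by simpa [hs₂, hc] using hF₁.ireg 0 rfl, by simpa [hs₂, hm] using hF₁.ireg 1 rfl,
        fun A => by simpa [hs₂, hdist] using congrFun (hF₁.rarr 0 rfl) A,
        fun A => by simpa [hs₂] using hcopy A A.2⟩,
      by simpa [hs₂] using hI, by simpa using potential_le m μ π, by simp [hs₂], by simp [hs₂],
      by simp, by simp [hs₂], ⟨fun _ _ => ⊤, by simp, by simp⟩⟩
  have hrounds := rep_induction 10 0 roundCode s₂ (fun i s' => ∃ x, Progress m μ π i x s')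
    ⟨π, hstart⟩ (by
      rintro i hi s' hi' hF ⟨x, hx⟩
      obtain ⟨α, -, -, h⟩ := hx.round hμ
      -- the loop counter is not part of the state
      exact ⟨_, ⟨h.ready.1, h.ready.2, h.ready.3, h.ready.4⟩, h.2, h.3, h.4, h.5, h.6, h.7, h.8⟩)
  rw [show s₂.ireg 0 = c from hstart.ready.types] at hrounds
  obtain ⟨x, hx⟩ := hrounds
  set s₃ := (Code.rep 10 0 roundCode).run s₂
  have hx0 : ∀ A, x A = 0 := (potential_eq_zero_iff hx.implementable.nonneg).1
    (by simpa using hx.potential_le)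
  obtain ⟨α, hα, hr, h⟩ := hx.round hμ
  have hα' : α = s₃.rreg 1 := by
    refine hα.eq.resolve_right ?_
    rintro (⟨A, hA, -⟩ | ⟨A, B, -, -, hAB, -⟩)
    · exact hA.ne' (hx0 A)
    · exact hAB.ne (by rw [hx0, hx0])
  rw [hα', sub_self] at hr
  obtain ⟨H, hH, hsum⟩ := h.hierarchies
  have hone := h.prob_sum
  rw [hr, add_zero, sum_range] at hone
  refine ⟨⟨c + 1, le_rfl, fun j => (roundCode.run s₃).rarr 2 j, fun j => h.prob_nonneg j j.2,
    hone, fun j => H j⟩, ⟨h.size, fun j => rfl, fun j A => hH j j.2 A⟩, fun i A => ?_⟩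
  rw [interim_mechanism, ← hsum i A, sum_range]
  simp [hx0, val]

theorem bounds_decomposeCode {y : ℕ} (hy : decomposeCode.bounds y) : y = 0 ∨ y = 1 := by
  simp [decomposeCode, roundCode, valuesCode, valueCode, tallyCode, tallyStep, powersCode, powCode,
    stepCode, vanishCode, mergeCode, minCode, subtractCode, bounds] at hy
  tauto

theorem exists_decompose_program : ∃ (p : Program) (K d : ℕ), ∀ (m c : ℕ) (μ π : Fin c → ℝ),
    1 ≤ m → IsDistribution μ → Implementable m μ 1 π → ∀ s, HoldsInstance s m μ π →
      ∃ (τ : ℕ) (s' : Store) (D : Description c), Exec p s τ s' ∧ τ ≤ K * (c * m) ^ d ∧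
        HoldsDescription s' D ∧ ExactlyImplements μ (D.mechanism m) π := by
  refine ⟨decomposeCode.toProgram, decomposeCode.weight, decomposeCode.depth,
    fun m c μ π hm hμ hI s hs => ?_⟩
  have hc : 1 ≤ c := by
    rcases Nat.eq_zero_or_pos c with rfl | h
    · simpa using hμ.2
    · exact h
  obtain ⟨D, hD, hexact⟩ := run_decomposeCode hμ hI hs
  obtain ⟨τ, hτ, hE⟩ := exec_toProgram decomposeCode rfl
    (fun y hy => by rcases bounds_decomposeCode hy with rfl | rfl <;> rfl) s
  refine ⟨τ, _, D, hE, hτ.trans (time_le (Nat.mul_pos hc hm) _ fun y hy => ?_), hD, hexact⟩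
  rcases bounds_decomposeCode hy with rfl | rfl
  · rw [hs.1]; exact Nat.le_mul_of_pos_right _ hm
  · rw [hs.2.1]; exact Nat.le_mul_of_pos_left _ hc

end Decompose

/-! ### Running a described mechanism -/

section Sample

variable {c m : ℕ}

/-- The probabilities of a description, continued by zero. -/
noncomputable def Description.weight (D : Description c) (j : ℕ) : ℝ :=
  if h : j < D.size then D.prob ⟨j, h⟩ else 0

/-- The total probability of the first `k` hierarchies. -/
noncomputable def Description.cumulative (D : Description c) (k : ℕ) : ℝ :=
  ∑ j ∈ range k, D.weight j

/-- Inverse transform sampling: the last of the first `n` hierarchies such that the total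
probability of its predecessors is at most `u`. -/
noncomputable def Description.sample (D : Description c) (u : ℝ) : ℕ → ℕ
  | 0 => 0
  | n + 1 => if D.cumulative n ≤ u then n else D.sample u n

section

variable (D : Description c)

theorem Description.weight_nonneg (j : ℕ) : 0 ≤ D.weight j := by
  unfold weight; split_ifs
  exacts [D.prob_nonneg _, le_rfl]

theorem Description.cumulative_mono : Monotone D.cumulative :=
  monotone_nat_of_le_succ fun k => by
    rw [cumulative, cumulative, sum_range_succ]
    exact le_add_of_nonneg_right (D.weight_nonneg k)

@[simp] theorem Description.cumulative_zero : D.cumulative 0 = 0 := by simp [cumulative]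

theorem Description.cumulative_size : D.cumulative D.size = 1 := by
  rw [cumulative, sum_range, ← D.prob_sum]
  exact sum_congr rfl fun k _ => by simp [weight]

theorem Description.cumulative_succ (k : Fin D.size) :
    D.cumulative (k + 1) = D.cumulative k + D.prob k := by
  simp [cumulative, sum_range_succ, weight]

theorem Description.size_pos : 0 < D.size := by
  by_contra! h
  have := D.cumulative_size
  rw [Nat.le_zero.1 h] at this
  simp at this

theorem Description.sample_lt (u : ℝ) {n : ℕ} (hn : 0 < n) : D.sample u n < n := by
  induction n with
  | zero => omega
  | succ n ih =>
    unfold sample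
    split_ifs
    · omega
    · rcases Nat.eq_zero_or_pos n with rfl | h
      · simp [sample]
      · have := ih h; omega

theorem Description.sample_spec {u : ℝ} (h0 : 0 ≤ u) {n : ℕ} (hn : u < D.cumulative n) :
    D.cumulative (D.sample u n) ≤ u ∧ u < D.cumulative (D.sample u n + 1) := by
  induction n with
  | zero => simp at hn; linarith
  | succ n ih =>
    unfold sample
    split_ifs with h
    · exact ⟨h, hn⟩
    · exact ih (not_le.1 h)

theorem Description.sample_eq {u : ℝ} {n k : ℕ} (hu : u < D.cumulative n)
    (h : D.cumulative k ≤ u) (h' : u < D.cumulative (k + 1)) : D.sample u n = k := by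
  obtain ⟨h1, h2⟩ := D.sample_spec (le_trans (by
    rw [← D.cumulative_zero]; exact D.cumulative_mono (Nat.zero_le k)) h) hu
  have h3 := D.cumulative_mono.reflect_lt (h1.trans_lt h')
  have h4 := D.cumulative_mono.reflect_lt (h.trans_lt h2)
  omega

/-- The bidders among whom the item is given away for the random number `u`. -/
noncomputable def Description.sampledWinners (t : Fin m → Fin c) (u : ℝ) : Finset (Fin m) :=
  winners (D.level ⟨D.sample u D.size, D.sample_lt u D.size_pos⟩) t

open MeasureTheory in
theorem Description.volume_sampledWinners (t : Fin m → Fin c) (S : Finset (Fin m)) :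
    volume {u : ℝ | u ∈ Set.Icc (0 : ℝ) 1 ∧ D.sampledWinners t u = S} =
      ENNReal.ofReal (∑ k with winners (D.level k) t = S, D.prob k) := by
  have hae : {u : ℝ | u ∈ Set.Icc (0 : ℝ) 1 ∧ D.sampledWinners t u = S} =ᵐ[volume]
      (⋃ k ∈ ({k | winners (D.level k) t = S} : Finset (Fin D.size)),
        Set.Ico (D.cumulative k) (D.cumulative (k + 1)) : Set ℝ) := by
    have hne : ∀ᵐ u : ℝ, u ≠ 1 := by simp [ae_iff]
    filter_upwards [hne] with u hu
    apply propext
    change (u ∈ Set.Icc (0 : ℝ) 1 ∧ D.sampledWinners t u = S) ↔ u ∈ ⋃ k ∈ _, _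
    simp only [Set.mem_iUnion, mem_filter, mem_univ, true_and, exists_prop, Set.mem_Ico]
    constructor
    · rintro ⟨⟨h0, h1⟩, hS⟩
      refine ⟨_, hS, D.sample_spec h0 ?_⟩
      rw [D.cumulative_size]
      exact lt_of_le_of_ne h1 hu
    · rintro ⟨k, hk, h1, h2⟩
      have h0 : 0 ≤ u := le_trans (by
        rw [← D.cumulative_zero]; exact D.cumulative_mono (Nat.zero_le _)) h1
      have h3 : u < D.cumulative D.size := h2.trans_le (D.cumulative_mono k.2)
      refine ⟨⟨h0, by rw [D.cumulative_size] at h3; exact h3.le⟩, ?_⟩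
      rw [sampledWinners, ← hk]
      congr 2
      exact Fin.ext (D.sample_eq h3 h1 h2)
  rw [measure_congr hae, measure_biUnion_finset, ENNReal.ofReal_sum_of_nonneg]
  · refine sum_congr rfl fun k _ => ?_
    rw [Real.volume_Ico, D.cumulative_succ, add_sub_cancel_left]
  · exact fun k _ => D.prob_nonneg k
  · intro k _ l _ hkl
    refine Set.disjoint_left.2 fun u hu hu' => hkl (Fin.ext ?_)
    have h1 := D.cumulative_mono.reflect_lt (hu.1.trans_lt hu'.2)
    have h2 := D.cumulative_mono.reflect_lt (hu'.1.trans_lt hu.2)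
    omega
  · exact fun k _ => measurableSet_Ico

end

@[simp] theorem encodeLevel_top : encodeLevel (⊤ : Level c) = c := rfl

@[simp] theorem encodeLevel_coe (a : Fin c) : encodeLevel (a : Level c) = a := rfl

theorem encodeLevel_lt_iff {a : Level c} : encodeLevel a < c ↔ a ≠ ⊤ := by
  induction a using WithTop.recTopCoe <;> simp

theorem encodeLevel_le_iff {a b : Level c} : encodeLevel a ≤ encodeLevel b ↔ a ≤ b := by
  induction a using WithTop.recTopCoe with
  | top =>
    rw [encodeLevel_top, ← not_lt, encodeLevel_lt_iff, not_not, top_le_iff]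
  | coe a =>
    induction b using WithTop.recTopCoe with
    | top => simp
    | coe b => simp

theorem encodeLevel_le (a : Level c) : encodeLevel a ≤ c :=
  encodeLevel_le_iff.2 (le_top : a ≤ ⊤)

/-- One round of the search for the hierarchy.  Real register `1` holds the total probability of the
hierarchies inspected so far, integer register `4` the position of the current one in the table; the
position of the one that is chosen goes to integer register `3`. -/
def searchStep : Code :=
  .cond (.rle (.reg 1) (.reg 0)) (.iset 3 (.reg 4)) .skip ;;
  .rset 1 (.add (.reg 1) (.get 2 (.reg 10))) ;; .iset 4 (.add (.reg 4) (.reg 0))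

/-- The level of the bidder in integer register `11`. -/
def levelExp : IExp := .get 0 (.add (.reg 3) (.get 1 (.reg 11)))

/-- One round of the computation of the smallest level. -/
def smallestStep : Code := .cond (.ile levelExp (.reg 5)) (.iset 5 levelExp) .skip

/-- Marks a bidder who is at the smallest level and does not lose. -/
def markStep : Code :=
  .cond (.conj (.ile levelExp (.reg 5)) (.ilt levelExp (.reg 0)))
    (.iput 2 (.reg 11) (.lit 1)) (.iput 2 (.reg 11) (.lit 0))

/-- Runs the mechanism whose description is stored in the memory. -/
def sampleCode : Code :=
  (.rset 1 (.ofInt (.lit 0)) ;; .iset 3 (.lit 0) ;; .iset 4 (.lit 0)) ;;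
  .rep 10 2 searchStep ;; .iset 5 (.reg 0) ;; .rep 11 1 smallestStep ;; .rep 11 1 markStep

theorem run_search {D : Description c} {t : Fin m → Fin c} {u : ℝ} {s : Store}
    (hs : HoldsAuction s D t u) (h1 : s.rreg 1 = 0) (h3 : s.ireg 3 = 0) (h4 : s.ireg 4 = 0) :
    ((Code.rep 10 2 searchStep).run s).ireg 3 = D.sample u D.size * c := by
  obtain ⟨hc, hm, ⟨hsize, hprob, -⟩, -, hu⟩ := hs
  have h := rep_induction 10 2 searchStep s (fun i s' => s'.rreg 1 = D.cumulative i ∧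
    s'.ireg 3 = D.sample u i * c ∧ s'.ireg 4 = i * c) (by simp [h1, h3, h4, Description.sample]) (by
      rintro i hi s' hi' hF ⟨e1, e3, e4⟩
      rw [hsize] at hi
      have e5 : s'.rarr 2 i = D.prob ⟨i, hi⟩ := by rw [hF.rarr 2 rfl, ← hprob]
      have e6 : s'.ireg 0 = c := by rw [hF.ireg 0 rfl, hc]
      have e7 : s'.rreg 0 = u := by rw [hF.rreg 0 rfl, hu]
      have e8 := D.cumulative_succ ⟨i, hi⟩
      simp only at e8
      simp [searchStep, Code.run, RExp.eval, IExp.eval, hi', e1, e3, e4, e5, e6, e7, e8,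
        Description.sample, add_mul, ite_mul])
  rw [hsize] at h
  exact h.2.1

theorem run_smallest {s : Store} {l : Fin m → ℕ} (hm : s.ireg 1 = m)
    (hl : ∀ i : Fin m, s.iarr 0 (s.ireg 3 + s.iarr 1 i) = l i) :
    ((Code.rep 11 1 smallestStep).run s).ireg 5 ≤ s.ireg 5 ∧
    (∀ i, ((Code.rep 11 1 smallestStep).run s).ireg 5 ≤ l i) ∧
    (((Code.rep 11 1 smallestStep).run s).ireg 5 = s.ireg 5 ∨
      ∃ i, ((Code.rep 11 1 smallestStep).run s).ireg 5 = l i) := by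
  have h := rep_induction 11 1 smallestStep s (fun i s' => s'.ireg 5 ≤ s.ireg 5 ∧
    (∀ j : Fin m, j < i → s'.ireg 5 ≤ l j) ∧ (s'.ireg 5 = s.ireg 5 ∨ ∃ j, s'.ireg 5 = l j))
    (by simp) (by
      rintro i hi s' hi' hF ⟨h1, h2, h3⟩
      rw [hm] at hi
      have hl' : levelExp.eval s' = l ⟨i, hi⟩ := by
        simp [levelExp, IExp.eval, hi', hF.iarr 0 rfl, hF.iarr 1 rfl, hF.ireg 3 rfl, ← hl]
      have key : ((smallestStep.run s').iset 11 (i + 1)).ireg 5 = min (s'.ireg 5) (l ⟨i, hi⟩) := by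
        by_cases h : l ⟨i, hi⟩ ≤ s'.ireg 5
        · simp [smallestStep, Code.run, hl', IExp.eval, h]
        · simp [smallestStep, Code.run, hl', IExp.eval, h, (not_le.1 h).le]
      rw [key]
      refine ⟨by omega, fun j hj => ?_, ?_⟩
      · rcases Nat.lt_succ_iff_lt_or_eq.1 hj with hj | hj
        · exact min_le_of_left_le (h2 j hj)
        · obtain rfl : j = ⟨i, hi⟩ := Fin.ext hj
          exact min_le_right _ _
      · rcases min_choice (s'.ireg 5) (l ⟨i, hi⟩) with h | h <;> rw [h]
        · exact h3
        · exact .inr ⟨_, rfl⟩)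
  rw [hm] at h
  exact ⟨h.1, fun i => h.2.1 i i.2, h.2.2⟩

theorem run_mark {s : Store} {l : Fin m → ℕ} (hm : s.ireg 1 = m) (hc : s.ireg 0 = c)
    (hl : ∀ i : Fin m, s.iarr 0 (s.ireg 3 + s.iarr 1 i) = l i) (i : Fin m) :
    ((Code.rep 11 1 markStep).run s).iarr 2 i = if l i ≤ s.ireg 5 ∧ l i < c then 1 else 0 := by
  have h := rep_induction 11 1 markStep s (fun i s' => ∀ j : Fin m, j < i →
    s'.iarr 2 j = if l j ≤ s.ireg 5 ∧ l j < c then 1 else 0)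
    (by simp) (by
      rintro i hi s' hi' hF h j hj
      rw [hm] at hi
      have hl' : levelExp.eval s' = l ⟨i, hi⟩ := by
        simp [levelExp, IExp.eval, hi', hF.iarr 0 rfl, hF.iarr 1 rfl, hF.ireg 3 rfl, ← hl]
      have e0 : s'.ireg 0 = c := by rw [hF.ireg 0 rfl, hc]
      have e5 := hF.ireg 5 rfl
      rcases Nat.lt_succ_iff_lt_or_eq.1 hj with hj | hj
      · simp [markStep, Code.run, hl', IExp.eval, hi', hj.ne, h j hj]
      · obtain rfl : j = ⟨i, hi⟩ := Fin.ext hj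
        simp [markStep, Code.run, hl', IExp.eval, hi', e0, e5])
  rw [hm] at h
  exact h i i.2

theorem run_sampleCode {D : Description c} {t : Fin m → Fin c} {u : ℝ} {s : Store}
    (hs : HoldsAuction s D t u) : HoldsSubset (sampleCode.run s) (D.sampledWinners t u) := by
  obtain ⟨hc, hm, ⟨hsize, hprob, htab⟩, ht, hu⟩ := hs
  have hrun : sampleCode.run s = (Code.rep 11 1 markStep).run ((Code.rep 11 1 smallestStep).run
      (((Code.rep 10 2 searchStep).run (((s.rset 1 0).iset 3 0).iset 4 0)).iset 5
        (((Code.rep 10 2 searchStep).run (((s.rset 1 0).iset 3 0).iset 4 0)).ireg 0))) := by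
    simp [sampleCode, Code.run, RExp.eval, IExp.eval]
  rw [hrun]
  set s₁ := ((s.rset 1 0).iset 3 0).iset 4 0 with hs₁
  have e₁ := run_search (D := D) (t := t) (u := u) (s := s₁)
    ⟨by simpa [hs₁], by simpa [hs₁], ⟨by simpa [hs₁], by simpa [hs₁], by simpa [hs₁]⟩,
      by simpa [hs₁], by simpa [hs₁]⟩ (by simp [hs₁]) (by simp [hs₁]) (by simp [hs₁])
  have hF₁ := frame_run (.rep 10 2 searchStep) s₁
  set s₂ := (Code.rep 10 2 searchStep).run s₁
  have i0 : s₂.ireg 0 = c := by rw [hF₁.ireg 0 rfl]; simpa [hs₁]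
  have i1 : s₂.ireg 1 = m := by rw [hF₁.ireg 1 rfl]; simpa [hs₁]
  set k : Fin D.size := ⟨D.sample u D.size, D.sample_lt u D.size_pos⟩ with hk
  set l : Fin m → ℕ := fun i => encodeLevel (D.level k (t i)) with hl
  have hl₂ : ∀ i : Fin m, s₂.iarr 0 (s₂.ireg 3 + s₂.iarr 1 i) = l i := fun i => by
    have : s₂.iarr 1 i = t i := by rw [hF₁.iarr 1 rfl]; simpa [hs₁] using ht i
    rw [this, e₁, hF₁.iarr 0 rfl]
    simpa [hs₁] using htab k (t i)
  have h5 := run_smallest (s := s₂.iset 5 (s₂.ireg 0)) (l := l) (by simpa) (by simpa)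
  have hF₃ := frame_run (.rep 11 1 smallestStep) (s₂.iset 5 (s₂.ireg 0))
  set s₃ := (Code.rep 11 1 smallestStep).run (s₂.iset 5 (s₂.ireg 0))
  have h6 := run_mark (s := s₃) (l := l) (c := c) (by rw [hF₃.ireg 1 rfl]; simpa)
    (by rw [hF₃.ireg 0 rfl]; simpa)
    (by rw [hF₃.iarr 0 rfl, hF₃.iarr 1 rfl, hF₃.ireg 3 rfl]; simpa)
  intro i
  rw [h6]
  refine if_congr ?_ rfl rfl
  rw [Description.sampledWinners, mem_winners, ← hk, ← encodeLevel_lt_iff]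
  obtain ⟨h7, h8, h9⟩ := h5
  simp only [← encodeLevel_le_iff]
  constructor
  · exact fun h => ⟨h.2, fun j => h.1.trans (h8 j)⟩
  · rintro ⟨h1, h2⟩
    refine ⟨?_, h1⟩
    rcases h9 with h9 | ⟨j, h9⟩
    · rw [h9]; simpa [i0] using encodeLevel_le _
    · rw [h9]; exact h2 j

theorem bounds_sampleCode {y : ℕ} (hy : sampleCode.bounds y) : y = 1 ∨ y = 2 := by
  simp [sampleCode, searchStep, smallestStep, markStep, bounds] at hy
  tauto

theorem exists_sample_program : ∃ (p : Program) (K d : ℕ),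
    ∀ (m c : ℕ) (D : Description c) (t : Fin m → Fin c), 1 ≤ m →
    ∃ W : ℝ → Finset (Fin m),
      (∀ S : Finset (Fin m),
        MeasureTheory.volume {u : ℝ | u ∈ Set.Icc (0 : ℝ) 1 ∧ W u = S} =
          ENNReal.ofReal (∑ k with winners (D.level k) t = S, D.prob k)) ∧
      ∀ u ∈ Set.Icc (0 : ℝ) 1, ∀ s : Store, HoldsAuction s D t u →
        ∃ (τ : ℕ) (s' : Store), Exec p s τ s' ∧ τ ≤ K * (c * m) ^ d ∧ HoldsSubset s' (W u) := by
  refine ⟨sampleCode.toProgram, sampleCode.weight * 2, sampleCode.depth,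
    fun m c D t hm => ⟨D.sampledWinners t, D.volume_sampledWinners t, fun u _ s hs => ?_⟩⟩
  have hc : 1 ≤ c := (t ⟨0, hm⟩).pos
  obtain ⟨τ, hτ, hE⟩ := exec_toProgram sampleCode rfl
    (fun y hy => by rcases bounds_sampleCode hy with rfl | rfl <;> rfl) s
  refine ⟨τ, _, hE, hτ.trans ?_, run_sampleCode hs⟩
  -- the number of hierarchies is at most `c + 1 ≤ 2 * (c * m)`
  refine (time_le (M := 2 * (c * m)) (by nlinarith) _ fun y hy => ?_).trans ?_
  · rcases bounds_sampleCode hy with rfl | rfl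
    · rw [hs.2.1]; nlinarith
    · rw [hs.2.2.1.1]
      have := D.size_le
      nlinarith
  · have : sampleCode.depth = 1 := rfl
    rw [this]
    exact le_of_eq (by ring)

end Sample

/-! ### Merge sort -/

section MergeSort

variable {key : ℕ → ℝ} {a b : ℕ → ℕ} {w c k i j mid hi lo : ℕ}

/-- The entries of `a` at the positions `lo, …, hi - 1` have decreasing keys. -/
def SortedOn (key : ℕ → ℝ) (a : ℕ → ℕ) (lo hi : ℕ) : Prop :=
  ∀ x y, lo ≤ x → x ≤ y → y < hi → key (a y) ≤ key (a x)

/-- The first `n` entries of `a`, cut into blocks of width `w`, have decreasing keys in every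
block. -/
def BlockSorted (key : ℕ → ℝ) (a : ℕ → ℕ) (w n : ℕ) : Prop :=
  ∀ d, SortedOn key a (d * w) (min ((d + 1) * w) n)

/-- The state of a merge pass from the array `a` with sorted blocks of width `w` to the array `b`,
of which `k` entries have been written.  The block of `b` under construction starts at `lo`, and is
merged from the positions `i, …, mid - 1` and `j, …, hi - 1` of `a`. -/
structure MergeState (key : ℕ → ℝ) (a : ℕ → ℕ) (w c k i j mid hi : ℕ) (b : ℕ → ℕ) (lo : ℕ) :
    Prop where
  start : ∃ d, lo = d * (2 * w)
  finish : hi = c ∨ ∃ d, hi = d * (2 * w)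
  lo_le : lo ≤ k
  le_hi : k ≤ hi
  hi_le : hi ≤ lo + 2 * w
  hi_le_size : hi ≤ c
  left_le : i ≤ mid
  mid_le : mid ≤ j
  right_le : j ≤ hi
  count : k + mid = i + j
  sorted_left : SortedOn key a i mid
  sorted_right : SortedOn key a j hi
  sorted : BlockSorted key b (2 * w) k
  perm : ∀ f : ℕ → ℝ,
    ∑ x ∈ range k, f (b x) = ∑ x ∈ range i, f (a x) + ∑ x ∈ Ico mid j, f (a x)
  le_written : ∀ x, lo ≤ x → x < k → ∀ y, i ≤ y ∧ y < mid ∨ j ≤ y ∧ y < hi → key (a y) ≤ key (b x)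

theorem MergeState.zero : MergeState key a w c 0 0 0 0 0 b 0 where
  start := ⟨0, by simp⟩
  finish := .inr ⟨0, by simp⟩
  lo_le := le_rfl
  le_hi := le_rfl
  hi_le := Nat.zero_le _
  hi_le_size := Nat.zero_le _
  left_le := le_rfl
  mid_le := le_rfl
  right_le := le_rfl
  count := rfl
  sorted_left := fun x y _ _ h => absurd h (Nat.not_lt_zero y)
  sorted_right := fun x y _ _ h => absurd h (Nat.not_lt_zero y)
  sorted := fun d x y _ _ h => by simp at h
  perm := by simp
  le_written := fun x _ h => absurd h (Nat.not_lt_zero x)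

theorem MergeState.perm_of_eq (h : MergeState key a w c k i j mid hi b lo) (hk : hi = k)
    (f : ℕ → ℝ) : ∑ x ∈ range k, f (b x) = ∑ x ∈ range k, f (a x) := by
  have h1 := h.count
  have h2 := h.left_le
  have h3 := h.right_le
  obtain rfl : i = mid := by omega
  obtain rfl : j = k := by omega
  rw [h.perm, sum_range_add_sum_Ico _ h.mid_le]

/-- When a block of `b` is complete, the next one is started. -/
theorem MergeState.next (h : MergeState key a w c k i j mid hi b lo) (hk : hi = k) (hkc : k < c)
    (ha : BlockSorted key a w c) :
    MergeState key a w c k k (min (k + w) c) (min (k + w) c) (min (min (k + w) c + w) c) b k := by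
  obtain ⟨d, hd⟩ := h.finish.resolve_left (by omega)
  have hblock : (2 * d + 1) * w = k + w := by rw [← hk, hd]; ring
  refine ⟨⟨d, by rw [← hk, hd]⟩, ?_, le_rfl, by omega, by omega, by omega, by omega, by omega,
    by omega, rfl, ?_, ?_, h.sorted, fun f => by simp [h.perm_of_eq hk], fun x hx hx' => by omega⟩
  · by_cases hw : k + w + w ≤ c
    · right
      refine ⟨d + 1, ?_⟩
      rw [min_eq_left (show k + w ≤ c by omega), min_eq_left hw, ← hk, hd]
      ring
    · left; omega
  · have := ha (2 * d)
    rwa [hblock, show 2 * d * w = k by rw [← hk, hd]; ring] at this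
  · have := ha (2 * d + 1)
    rw [hblock, show (2 * d + 1 + 1) * w = k + w + w by rw [← hblock]; ring] at this
    intro x y hx hxy hy
    exact this x y (by omega) hxy (by omega)

theorem BlockSorted.update (h : BlockSorted key b w k) {v : ℕ} (hlo : ∃ d, lo = d * w)
    (hk : k < lo + w) (hlok : lo ≤ k) (hv : ∀ x, lo ≤ x → x < k → key v ≤ key (b x)) :
    BlockSorted key (Function.update b k v) w (k + 1) := by
  intro d x y hx hxy hy
  rcases (show y ≤ k by omega).eq_or_lt with rfl | hyk
  · rcases hxy.eq_or_lt with rfl | hxy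
    · exact le_rfl
    rw [Function.update_self, Function.update_of_ne hxy.ne]
    refine hv x ?_ hxy
    obtain ⟨e, rfl⟩ := hlo
    -- position `k` lies in the blocks number `d` and number `e`, which are therefore the same
    have h1 : e < d + 1 := by
      by_contra! hcon
      have := Nat.mul_le_mul_right w hcon
      omega
    have h2 : d < e + 1 := by
      by_contra! hcon
      have := Nat.mul_le_mul_right w hcon
      rw [add_mul, one_mul] at this
      omega
    obtain rfl : d = e := by omega
    exact hx
  · rw [Function.update_of_ne hyk.ne, Function.update_of_ne (by omega)]
    exact h d x y hx hxy (by omega)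

theorem MergeState.takeLeft (h : MergeState key a w c k i j mid hi b lo) (hi_mid : i < mid)
    (hle : j < hi → key (a j) ≤ key (a i)) :
    MergeState key a w c (k + 1) (i + 1) j mid hi (Function.update b k (a i)) lo := by
  have h1 := h.count
  have h2 := h.right_le
  have h3 := h.hi_le
  refine ⟨h.start, h.finish, h.lo_le.trans (Nat.le_succ k), by omega, h.hi_le, h.hi_le_size, hi_mid,
    h.mid_le, h.right_le, by omega, fun x y hx => h.sorted_left x y (by omega), h.sorted_right,
    h.sorted.update h.start (by omega) h.lo_le
      fun x hx hxk => h.le_written x hx hxk i (.inl ⟨le_rfl, hi_mid⟩), fun f => ?_, ?_⟩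
  · rw [sum_range_succ, sum_range_succ, Function.update_self, sum_congr rfl fun x hx => by
      rw [Function.update_of_ne (mem_range.1 hx).ne], h.perm]
    ring
  · intro x hx hxk y hy
    rcases (Nat.lt_succ_iff.1 hxk).eq_or_lt with rfl | hxk
    · rw [Function.update_self]
      rcases hy with hy | hy
      · exact h.sorted_left i y le_rfl (by omega) hy.2
      · exact (h.sorted_right j y le_rfl hy.1 hy.2).trans (hle (by omega))
    · rw [Function.update_of_ne hxk.ne]
      exact h.le_written x hx hxk y (by omega)

theorem MergeState.takeRight (h : MergeState key a w c k i j mid hi b lo) (hj_hi : j < hi)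
    (hle : i < mid → key (a i) ≤ key (a j)) :
    MergeState key a w c (k + 1) i (j + 1) mid hi (Function.update b k (a j)) lo := by
  have h1 := h.count
  have h2 := h.left_le
  have h3 := h.hi_le
  refine ⟨h.start, h.finish, h.lo_le.trans (Nat.le_succ k), by omega, h.hi_le, h.hi_le_size, h2,
    h.mid_le.trans (Nat.le_succ j), hj_hi, by omega, h.sorted_left,
    fun x y hx => h.sorted_right x y (by omega), h.sorted.update h.start (by omega) h.lo_le
      fun x hx hxk => h.le_written x hx hxk j (.inr ⟨le_rfl, hj_hi⟩), fun f => ?_, ?_⟩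
  · rw [sum_range_succ, sum_Ico_succ_top h.mid_le, Function.update_self,
      sum_congr rfl fun x hx => by rw [Function.update_of_ne (mem_range.1 hx).ne], h.perm]
    ring
  · intro x hx hxk y hy
    rcases (Nat.lt_succ_iff.1 hxk).eq_or_lt with rfl | hxk
    · rw [Function.update_self]
      rcases hy with hy | hy
      · exact (h.sorted_left i y le_rfl hy.1 hy.2).trans (hle (by omega))
      · exact h.sorted_right j y le_rfl (by omega) hy.2
    · rw [Function.update_of_ne hxk.ne]
      exact h.le_written x hx hxk y (by omega)

/-- If the current block is complete, prepares the next one: integer registers `3` and `4` hold the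
positions from which the two halves are read, `8` and `9` the ends of the halves. -/
def nextBlockCode : Code :=
  .cond (.ile (.reg 9) (.reg 11))
    (.iset 3 (.reg 11) ;; .iset 8 (.add (.reg 11) (.reg 6)) ;;
      .cond (.ile (.reg 8) (.reg 0)) .skip (.iset 8 (.reg 0)) ;;
      .iset 4 (.reg 8) ;; .iset 9 (.add (.reg 8) (.reg 6)) ;;
      .cond (.ile (.reg 9) (.reg 0)) .skip (.iset 9 (.reg 0)))
    .skip

/-- Moves one entry from integer array `3` to integer array `4`. -/
def moveCode : Code :=
  .cond (.conj (.ilt (.reg 3) (.reg 8)) (.disj (.ile (.reg 9) (.reg 4))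
      (.rle (.get 1 (.get 3 (.reg 4))) (.get 1 (.get 3 (.reg 3))))))
    (.iput 4 (.reg 11) (.get 3 (.reg 3)) ;; .iset 3 (.add (.reg 3) (.lit 1)))
    (.iput 4 (.reg 11) (.get 3 (.reg 4)) ;; .iset 4 (.add (.reg 4) (.lit 1)))

/-- `MergeState` for the registers and arrays of the program. -/
def Merging (w k : ℕ) (s : Store) : Prop :=
  ∃ lo, MergeState (s.rarr 1) (s.iarr 3) w (s.ireg 0) k (s.ireg 3) (s.ireg 4) (s.ireg 8) (s.ireg 9)
    (s.iarr 4) lo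

theorem run_nextBlockCode {s : Store} (h : Merging (s.ireg 6) k s) (hk : s.ireg 11 = k)
    (hkc : k < s.ireg 0) (hw : 0 < s.ireg 6)
    (ha : BlockSorted (s.rarr 1) (s.iarr 3) (s.ireg 6) (s.ireg 0)) :
    Merging (s.ireg 6) k (nextBlockCode.run s) ∧ k < (nextBlockCode.run s).ireg 9 := by
  obtain ⟨lo, h⟩ := h
  by_cases hhi : s.ireg 9 ≤ k
  · have h8 : ((nextBlockCode).run s).ireg 8 = min (k + s.ireg 6) (s.ireg 0) := by
      simp [nextBlockCode, Code.run, IExp.eval, hk, hhi, min_def]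
    have h9 : ((nextBlockCode).run s).ireg 9 =
        min (min (k + s.ireg 6) (s.ireg 0) + s.ireg 6) (s.ireg 0) := by
      simp [nextBlockCode, Code.run, IExp.eval, hk, hhi, min_def]
    have h4 : ((nextBlockCode).run s).ireg 4 = min (k + s.ireg 6) (s.ireg 0) := by
      simp [nextBlockCode, Code.run, IExp.eval, hk, hhi, min_def]
    have h3 : ((nextBlockCode).run s).ireg 3 = k := by
      simp [nextBlockCode, Code.run, IExp.eval, hk, hhi]
    have hF := frame_run nextBlockCode s
    refine ⟨⟨k, ?_⟩, by rw [h9]; omega⟩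
    rw [h8, h9, h4, h3, hF.rarr 1 rfl, hF.iarr 3 rfl, hF.iarr 4 rfl, hF.ireg 0 rfl]
    exact h.next (le_antisymm hhi h.le_hi) hkc ha
  · have : nextBlockCode.run s = s := by simp [nextBlockCode, Code.run, IExp.eval, hk, hhi]
    rw [this]
    exact ⟨⟨lo, h⟩, not_le.1 hhi⟩

theorem run_moveCode {s : Store} (h : Merging w k s) (hk : s.ireg 11 = k)
    (hhi : k < s.ireg 9) : Merging w (k + 1) (moveCode.run s) := by
  obtain ⟨lo, h⟩ := h
  refine ⟨lo, ?_⟩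
  have h1 := h.count
  have h2 := h.left_le
  have h3 := h.right_le
  have hF := frame_run moveCode s
  rw [hF.rarr 1 rfl, hF.iarr 3 rfl, hF.ireg 0 rfl, hF.ireg 8 rfl, hF.ireg 9 rfl]
  by_cases hcond : s.ireg 3 < s.ireg 8 ∧ (s.ireg 9 ≤ s.ireg 4 ∨
      s.rarr 1 (s.iarr 3 (s.ireg 4)) ≤ s.rarr 1 (s.iarr 3 (s.ireg 3)))
  · have e : moveCode.run s =
        (s.iput 4 k (s.iarr 3 (s.ireg 3))).iset 3 (s.ireg 3 + 1) := by
      simp [moveCode, Code.run, RExp.eval, IExp.eval, hk, hcond]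
    have e' : (moveCode.run s).iarr 4 =
        Function.update (s.iarr 4) k (s.iarr 3 (s.ireg 3)) := by
      funext x; simp [e, Function.update_apply]
    rw [e', e]
    simpa using h.takeLeft hcond.1 fun hj => hcond.2.resolve_left hj.not_ge
  · have e : moveCode.run s =
        (s.iput 4 k (s.iarr 3 (s.ireg 4))).iset 4 (s.ireg 4 + 1) := by
      simp only [moveCode, Code.run, Test.holds_conj, Test.holds_disj, Test.holds_ilt,
        Test.holds_ile, Test.holds_rle, RExp.eval, IExp.eval, hk, hcond, if_false]
      simp
    have e' : (moveCode.run s).iarr 4 =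
        Function.update (s.iarr 4) k (s.iarr 3 (s.ireg 4)) := by
      funext x; simp [e, Function.update_apply]
    rw [e', e]
    have hj : s.ireg 4 < s.ireg 9 := by
      by_contra! hj
      exact hcond ⟨by omega, .inl hj⟩
    simpa using h.takeRight hj fun hi' => by
      by_contra! hlt
      exact hcond ⟨hi', .inr hlt.le⟩

/-- A merge pass, which doubles the width (in integer register `6`) of the sorted blocks of integer
array `3`. -/
def passCode : Code :=
  (.iset 3 (.lit 0) ;; .iset 4 (.lit 0) ;; .iset 8 (.lit 0) ;; .iset 9 (.lit 0)) ;;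
  .rep 11 0 (nextBlockCode ;; moveCode) ;;
  .rep 11 0 (.iput 3 (.reg 11) (.get 4 (.reg 11))) ;; .iset 6 (.add (.reg 6) (.reg 6))

theorem run_copy (s : Store) {x : ℕ} (hx : x < s.ireg 0) :
    ((Code.rep 11 0 (.iput 3 (.reg 11) (.get 4 (.reg 11)))).run s).iarr 3 x = s.iarr 4 x := by
  have h := rep_induction 11 0 (.iput 3 (.reg 11) (.get 4 (.reg 11))) s
    (fun i s' => ∀ x < i, s'.iarr 3 x = s.iarr 4 x) (by simp) (by
      rintro i hi s' hi' hF h x hx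
      have e := hF.iarr 4 rfl
      rcases Nat.lt_succ_iff_lt_or_eq.1 hx with hx | rfl
      · simp [Code.run, IExp.eval, hi', hx.ne, h x hx]
      · simp [Code.run, IExp.eval, hi', e])
  exact h x hx

theorem BlockSorted.congr (h : BlockSorted key b w c) (hab : ∀ x < c, a x = b x) :
    BlockSorted key a w c := fun d x y hx hxy hy => by
  rw [hab x (by omega), hab y (by omega)]
  exact h d x y hx hxy hy

theorem run_passCode {s : Store} (hw : 0 < s.ireg 6)
    (ha : BlockSorted (s.rarr 1) (s.iarr 3) (s.ireg 6) (s.ireg 0)) :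
    BlockSorted (s.rarr 1) ((passCode.run s).iarr 3) (2 * s.ireg 6) (s.ireg 0) ∧
    (passCode.run s).ireg 6 = 2 * s.ireg 6 ∧
    ∀ f : ℕ → ℝ, ∑ x ∈ range (s.ireg 0), f ((passCode.run s).iarr 3 x) =
      ∑ x ∈ range (s.ireg 0), f (s.iarr 3 x) := by
  set s₁ := (((s.iset 3 0).iset 4 0).iset 8 0).iset 9 0 with hs₁
  have hmerge := rep_induction 11 0 (nextBlockCode ;; moveCode) s₁
    (fun i s' => Merging (s.ireg 6) i s')
    ⟨0, by simpa [hs₁] using MergeState.zero⟩ (by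
      rintro i hi s' hi' hF h
      have e6 : s'.ireg 6 = s.ireg 6 := by rw [hF.ireg 6 rfl]; simp [hs₁]
      have e0 : s'.ireg 0 = s.ireg 0 := by rw [hF.ireg 0 rfl]; simp [hs₁]
      have e1 : s'.rarr 1 = s.rarr 1 := by rw [hF.rarr 1 rfl]; simp [hs₁]
      have e3 : s'.iarr 3 = s.iarr 3 := by rw [hF.iarr 3 rfl]; simp [hs₁]
      have hic : i < s.ireg 0 := by simpa [hs₁] using hi
      rw [← e6] at h
      obtain ⟨h1, h2⟩ := run_nextBlockCode h hi' (by rw [e0]; exact hic) (by rw [e6]; exact hw)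
        (by rw [e0, e1, e3, e6]; exact ha)
      obtain ⟨lo, h3⟩ := run_moveCode h1
        (by rw [(frame_run nextBlockCode s').ireg 11 rfl, hi']) h2
      rw [e6] at h3
      exact ⟨lo, by simpa [Code.run] using h3⟩)
  have hF := frame_run (.rep 11 0 (nextBlockCode ;; moveCode)) s₁
  obtain ⟨lo, h⟩ := hmerge
  set s₂ := (Code.rep 11 0 (nextBlockCode ;; moveCode)).run s₁
  have hcopy := fun x => run_copy s₂ (x := x)
  have hF' := frame_run (.rep 11 0 (.iput 3 (.reg 11) (.get 4 (.reg 11)))) s₂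
  set s₃ := (Code.rep 11 0 (.iput 3 (.reg 11) (.get 4 (.reg 11)))).run s₂
  rw [show passCode.run s = s₃.iset 6 (s₃.ireg 6 + s₃.ireg 6) from rfl]
  have e0 : s₂.ireg 0 = s.ireg 0 := by rw [hF.ireg 0 rfl]; simp [hs₁]
  have e1 : s₂.rarr 1 = s.rarr 1 := by rw [hF.rarr 1 rfl]; simp [hs₁]
  have e3 : s₂.iarr 3 = s.iarr 3 := by rw [hF.iarr 3 rfl]; simp [hs₁]
  have e6 : s₃.ireg 6 = s.ireg 6 := by rw [hF'.ireg 6 rfl, hF.ireg 6 rfl]; simp [hs₁]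
  have e0' : s₁.ireg 0 = s.ireg 0 := by simp [hs₁]
  rw [e0] at hcopy
  rw [e0, e0', e1, e3] at h
  refine ⟨?_, by simp [e6]; ring, fun f => ?_⟩
  · simpa using h.sorted.congr fun x hx => hcopy x hx
  · rw [← h.perm_of_eq (le_antisymm h.hi_le_size h.le_hi)]
    exact sum_congr rfl fun x hx => by simp [hcopy x (mem_range.1 hx)]

/-- Sorts the types by decreasing entries of array `1`; the sorted list of types goes to integer
array `3`.  Integer register `5` contains the number of merge passes. -/
def sortCode : Code :=
  .rep 11 0 (.iput 3 (.reg 11) (.reg 11)) ;; .iset 6 (.lit 1) ;; .rep 10 5 passCode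

theorem run_sortCode {s : Store} (hL : s.ireg 0 ≤ 2 ^ s.ireg 5) :
    SortedOn (s.rarr 1) ((sortCode.run s).iarr 3) 0 (s.ireg 0) ∧
    ∀ f : ℕ → ℝ, ∑ x ∈ range (s.ireg 0), f ((sortCode.run s).iarr 3 x) =
      ∑ x ∈ range (s.ireg 0), f x := by
  have hid := rep_induction 11 0 (.iput 3 (.reg 11) (.reg 11)) s
    (fun i s' => ∀ x < i, s'.iarr 3 x = x) (by simp) (by
      rintro i hi s' hi' hF h x hx
      rcases Nat.lt_succ_iff_lt_or_eq.1 hx with hx | rfl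
      · simp [Code.run, IExp.eval, hi', hx.ne, h x hx]
      · simp [Code.run, IExp.eval, hi'])
  have hF := frame_run (.rep 11 0 (.iput 3 (.reg 11) (.reg 11))) s
  rw [show sortCode.run s = (Code.rep 10 5 passCode).run
    (((Code.rep 11 0 (.iput 3 (.reg 11) (.reg 11))).run s).iset 6 1) from rfl]
  set s₁ := (Code.rep 11 0 (.iput 3 (.reg 11) (.reg 11))).run s
  set s₂ := s₁.iset 6 1 with hs₂
  have e0 : s₂.ireg 0 = s.ireg 0 := by simpa [hs₂] using hF.ireg 0 rfl
  have e5 : s₂.ireg 5 = s.ireg 5 := by simpa [hs₂] using hF.ireg 5 rfl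
  have e1 : s₂.rarr 1 = s.rarr 1 := by simpa [hs₂] using hF.rarr 1 rfl
  have h := rep_induction 10 5 passCode s₂ (fun i s' =>
    BlockSorted (s.rarr 1) (s'.iarr 3) (2 ^ i) (s.ireg 0) ∧ s'.ireg 6 = 2 ^ i ∧
      ∀ f : ℕ → ℝ, ∑ x ∈ range (s.ireg 0), f (s'.iarr 3 x) = ∑ x ∈ range (s.ireg 0), f x) (by
      refine ⟨fun d x y hx hxy hy => ?_, by simp [hs₂], fun f => ?_⟩
      · obtain rfl : x = y := by omega
        exact le_rfl
      · exact sum_congr rfl fun x hx => by simp [hs₂, hid x (mem_range.1 hx)]) (by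
      rintro i hi s' hi' hF' ⟨h1, h2, h3⟩
      have f0 : s'.ireg 0 = s.ireg 0 := by rw [hF'.ireg 0 rfl, e0]
      have f1 : s'.rarr 1 = s.rarr 1 := by rw [hF'.rarr 1 rfl, e1]
      obtain ⟨g1, g2, g3⟩ := run_passCode (s := s') (by rw [h2]; positivity)
        (by rw [h2, f0, f1]; exact h1)
      rw [f0, f1, h2, ← pow_succ'] at g1
      rw [h2, ← pow_succ'] at g2
      simp only [f0, h3] at g3
      exact ⟨by simpa using g1, by simpa using g2, by simpa using g3⟩)
  rw [e5] at h
  refine ⟨?_, h.2.2⟩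
  have := h.1 0
  rwa [zero_mul, zero_add, one_mul, min_eq_right hL] at this

end MergeSort

/-! ### Deciding feasibility -/

section Decide

variable {c m : ℕ} {μ π : Fin c → ℝ} {σ : Fin c → Fin c} {s : Store}

/-- Computes the number of merge passes, the logarithm of the number of types rounded up.  Running
the loop `c` times is enough as `c ≤ 2 ^ c`. -/
def passesCode : Code :=
  .iset 5 (.lit 0) ;; .iset 6 (.lit 1) ;;
  .rep 10 0 (.cond (.ilt (.reg 6) (.reg 0))
    (.iset 6 (.add (.reg 6) (.reg 6)) ;; .iset 5 (.add (.reg 5) (.lit 1))) .skip)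

theorem run_passesCode (s : Store) (hc : 1 ≤ s.ireg 0) :
    s.ireg 0 ≤ 2 ^ (passesCode.run s).ireg 5 ∧
      2 ^ (passesCode.run s).ireg 5 ≤ 2 * s.ireg 0 := by
  have h := rep_induction 10 0 (.cond (.ilt (.reg 6) (.reg 0))
    (.iset 6 (.add (.reg 6) (.reg 6)) ;; .iset 5 (.add (.reg 5) (.lit 1))) .skip)
    ((s.iset 5 0).iset 6 1) (fun i s' => s'.ireg 6 = 2 ^ s'.ireg 5 ∧
      (s.ireg 0 ≤ 2 ^ s'.ireg 5 ∨ s'.ireg 5 = i) ∧ 2 ^ s'.ireg 5 ≤ 2 * s.ireg 0)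
    (by simp; omega) (by
      rintro i hi s' hi' hF ⟨h1, h2, h3⟩
      have e0 : s'.ireg 0 = s.ireg 0 := by simpa using hF.ireg 0 rfl
      by_cases hlt : 2 ^ s'.ireg 5 < s.ireg 0
      · have h4 := h2.resolve_left hlt.not_ge
        simp [Code.run, IExp.eval, h1, e0, hlt, pow_succ]
        omega
      · simp [Code.run, IExp.eval, h1, e0, hlt]
        omega)
  have e0 : ((s.iset 5 0).iset 6 1).ireg 0 = s.ireg 0 := by simp
  rw [e0] at h
  refine ⟨?_, h.2.2⟩
  rcases h.2.1 with h | h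
  · exact h
  · change s.ireg 0 ≤ 2 ^ ((Code.rep 10 0 _).run ((s.iset 5 0).iset 6 1)).ireg 5
    rw [h]
    exact Nat.lt_two_pow_self.le

/-- The set of the first `n` types in the order given by `σ`. -/
def firstTypes (σ : Fin c → Fin c) (n : ℕ) : Finset (Fin c) := image σ (below c n)

/-- Border's condition for the set `S`. -/
def Border (m : ℕ) (μ π : Fin c → ℝ) (S : Finset (Fin c)) : Prop :=
  m * ∑ A ∈ S, μ A * π A ≤ 1 - (1 - ∑ A ∈ S, μ A) ^ m

theorem sum_firstTypes (hσ : Function.Injective σ) (f : Fin c → ℝ) (n : ℕ) :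
    ∑ A ∈ firstTypes σ n, f A = ∑ x ∈ below c n, f (σ x) :=
  sum_image fun _ _ _ _ h => hσ h

/-- If the types are sorted by decreasing values of `π`, it suffices to check Border's condition for
initial segments. -/
theorem implementable_of_border (hm : 1 ≤ m) (hμ : IsDistribution μ) (hπ : IsReducedForm π)
    (hσ : Function.Surjective σ) (hsort : ∀ x y, x ≤ y → π (σ y) ≤ π (σ x))
    (h : ∀ n ≤ c, Border m μ π (firstTypes σ n)) : Implementable m μ 1 π := by
  classical
  refine implementable_one hπ fun S hS => ?_
  rcases hm.eq_or_lt with rfl | hm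
  · simp only [Nat.cast_one, one_mul, pow_one, sub_sub_cancel]
    exact sum_le_sum fun A _ => mul_le_of_le_one_right (hμ.1 A) (hπ A).2
  rcases S.eq_empty_or_nonempty with rfl | ⟨A₀, hA₀⟩
  · simp
  obtain ⟨x₀, hx₀⟩ := hσ A₀
  obtain ⟨x, hx, hmax⟩ := exists_max_image (univ.filter fun x => σ x ∈ S) id
    ⟨x₀, by simpa [hx₀] using hA₀⟩
  simp only [mem_filter, mem_univ, true_and, id] at hx hmax
  have hsub : S ⊆ firstTypes σ (x + 1) := fun A hA => by
    obtain ⟨y, rfl⟩ := hσ A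
    exact mem_image_of_mem _ (mem_below.2 (Nat.lt_succ_of_le (Fin.le_def.1 (hmax y hA))))
  have hzero : ∀ A ∈ firstTypes σ (x + 1), A ∉ S → μ A = 0 := by
    intro A hA hAS
    obtain ⟨y, hy, rfl⟩ := mem_image.1 hA
    have hyx : y ≤ x := Fin.le_def.2 (Nat.le_of_lt_succ (mem_below.1 hy))
    by_contra hne
    exact (hS _ hx _ hAS ⟨hm, (hμ.1 _).lt_of_ne' hne⟩).not_ge (hsort y x hyx)
  have := h (x + 1) x.2
  rw [Border, ← sum_subset hsub hzero, ← sum_subset hsub fun A hA hAS => by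
    rw [hzero A hA hAS, zero_mul]] at this
  exact this

/-- Adds the type at position `11` of the sorted list to an initial segment: real registers `2` and
`3` hold the sums of `μ` and of `μ * π`, and register `4` the probability that no bidder has a type
in the segment. -/
def segmentCode : Code :=
  .rset 2 (.add (.reg 2) (.get 0 (.get 3 (.reg 11)))) ;;
  .rset 3 (.add (.reg 3) (.mul (.get 0 (.get 3 (.reg 11))) (.get 1 (.get 3 (.reg 11))))) ;;
  .rset 6 (.sub (.ofInt (.lit 1)) (.reg 2)) ;; powCode 4 6 13

theorem run_segmentCode (s : Store) :
    (segmentCode.run s).rreg 2 = s.rreg 2 + s.rarr 0 (s.iarr 3 (s.ireg 11)) ∧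
    (segmentCode.run s).rreg 3 = s.rreg 3 +
      s.rarr 0 (s.iarr 3 (s.ireg 11)) * s.rarr 1 (s.iarr 3 (s.ireg 11)) ∧
    (segmentCode.run s).rreg 4 =
      (1 - (s.rreg 2 + s.rarr 0 (s.iarr 3 (s.ireg 11)))) ^ s.ireg 1 := by
  rw [show segmentCode.run s = (powCode 4 6 13).run
    ((Code.rset 6 (.sub (.ofInt (.lit 1)) (.reg 2))).run ((Code.rset 3 (.add (.reg 3)
      (.mul (.get 0 (.get 3 (.reg 11))) (.get 1 (.get 3 (.reg 11)))))).run
    ((Code.rset 2 (.add (.reg 2) (.get 0 (.get 3 (.reg 11))))).run s))) from rfl]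
  rw [(frame_run (powCode 4 6 13) _).rreg 2 rfl, (frame_run (powCode 4 6 13) _).rreg 3 rfl,
    run_powCode (by simp)]
  simp [Code.run, RExp.eval, IExp.eval]

/-- One round of the check of Border's condition; for a violating segment, its size goes to integer
register `7` and the right-hand side to real register `0`. -/
def borderStep : Code :=
  segmentCode ;;
  .cond (.rle (.mul (.ofInt (.reg 1)) (.reg 3)) (.sub (.ofInt (.lit 1)) (.reg 4))) .skip
    (.iset 2 (.lit 0) ;; .iset 7 (.add (.reg 11) (.lit 1)) ;;
      .rset 0 (.sub (.ofInt (.lit 1)) (.reg 4)))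

/-- Checks Border's condition for all initial segments.  The size of a violating one goes to integer
register `7`. -/
def borderCode : Code :=
  (.rset 2 (.ofInt (.lit 0)) ;; .rset 3 (.ofInt (.lit 0)) ;; .iset 2 (.lit 1)) ;;
  .rep 11 0 borderStep

theorem run_borderCode (hc : s.ireg 0 = c) (hm : s.ireg 1 = m)
    (hdist : ∀ A : Fin c, s.rarr 0 A = μ A) (hform : ∀ A : Fin c, s.rarr 1 A = π A)
    (hσ : ∀ x : Fin c, s.iarr 3 x = σ x) (hinj : Function.Injective σ) :
    ((borderCode.run s).ireg 2 = 1 ∧ ∀ n ≤ c, Border m μ π (firstTypes σ n)) ∨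
    ((borderCode.run s).ireg 2 = 0 ∧ ∃ n, (borderCode.run s).ireg 7 = n ∧
      ¬ Border m μ π (firstTypes σ n) ∧
      (borderCode.run s).rreg 0 = 1 - (1 - ∑ A ∈ firstTypes σ n, μ A) ^ m) := by
  set s₁ := ((s.rset 2 0).rset 3 0).iset 2 1 with hs₁
  have h := rep_induction 11 0 borderStep s₁ (fun i s' =>
    s'.rreg 2 = ∑ A ∈ firstTypes σ i, μ A ∧ s'.rreg 3 = ∑ A ∈ firstTypes σ i, μ A * π A ∧
    (s'.ireg 2 = 1 ∧ (∀ n ≤ i, Border m μ π (firstTypes σ n)) ∨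
    s'.ireg 2 = 0 ∧ ∃ n, s'.ireg 7 = n ∧ ¬ Border m μ π (firstTypes σ n) ∧
      s'.rreg 0 = 1 - (1 - ∑ A ∈ firstTypes σ n, μ A) ^ m))
    (by simp [hs₁, firstTypes, Border]) (by
      rintro i hi s' hi' hF ⟨h2, h3, h4⟩
      have hic : i < c := by simpa [hs₁, hc] using hi
      have e1 : s'.ireg 1 = m := by rw [hF.ireg 1 rfl]; simpa [hs₁]
      have e2 : s'.rarr 0 (σ ⟨i, hic⟩) = μ (σ ⟨i, hic⟩) := by
        rw [hF.rarr 0 rfl]; simpa [hs₁] using hdist _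
      have e3 : s'.rarr 1 (σ ⟨i, hic⟩) = π (σ ⟨i, hic⟩) := by
        rw [hF.rarr 1 rfl]; simpa [hs₁] using hform _
      have e4 : s'.iarr 3 i = σ ⟨i, hic⟩ := by
        rw [hF.iarr 3 rfl]; simpa [hs₁] using hσ ⟨i, hic⟩
      have f2 : ∑ A ∈ firstTypes σ (i + 1), μ A = s'.rreg 2 + μ (σ ⟨i, hic⟩) := by
        rw [h2, sum_firstTypes hinj, sum_firstTypes hinj, sum_below_succ hic]
      have f3 : ∑ A ∈ firstTypes σ (i + 1), μ A * π A =
          s'.rreg 3 + μ (σ ⟨i, hic⟩) * π (σ ⟨i, hic⟩) := by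
        rw [h3, sum_firstTypes hinj, sum_firstTypes hinj, sum_below_succ hic]
      obtain ⟨g2, g3, g4⟩ := run_segmentCode s'
      rw [hi', e4, e2] at g2 g3 g4
      rw [← f2] at g2 g4
      rw [e3, ← f3] at g3
      rw [e1] at g4
      have hF₂ := frame_run segmentCode s'
      simp only [borderStep, Code.run]
      set s₃ := segmentCode.run s'
      have g1 : s₃.ireg 1 = m := by rw [hF₂.ireg 1 rfl, e1]
      have g5 : s₃.ireg 2 = s'.ireg 2 := by rw [hF₂.ireg 2 rfl]
      have g6 : s₃.ireg 7 = s'.ireg 7 := by rw [hF₂.ireg 7 rfl]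
      have g7 : s₃.rreg 0 = s'.rreg 0 := by rw [hF₂.rreg 0 rfl]
      have g8 : s₃.ireg 11 = i := by rw [hF₂.ireg 11 rfl, hi']
      by_cases hB : Border m μ π (firstTypes σ (i + 1))
      · have hB' := hB
        unfold Border at hB'
        have htest : RExp.eval s₃ (.mul (.ofInt (.reg 1)) (.reg 3)) ≤
            RExp.eval s₃ (.sub (.ofInt (.lit 1)) (.reg 4)) := by
          simpa [RExp.eval, IExp.eval, g1, g3, g4] using hB'
        simp only [Test.holds_rle, htest, if_true]
        refine ⟨by simpa using g2, by simpa using g3, h4.imp (fun h => ⟨by simp [g5, h.1], ?_⟩)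
          (fun h => ⟨by simp [g5, h.1], ?_⟩)⟩
        · intro n hn
          rcases Nat.le_succ_iff.1 hn with hn | rfl
          exacts [h.2 n hn, hB]
        · simpa [g6, g7] using h.2
      · have hB' := hB
        unfold Border at hB'
        have htest : ¬ RExp.eval s₃ (.mul (.ofInt (.reg 1)) (.reg 3)) ≤
            RExp.eval s₃ (.sub (.ofInt (.lit 1)) (.reg 4)) := by
          simpa [RExp.eval, IExp.eval, g1, g3, g4] using hB'
        simp only [Test.holds_rle, htest, if_false]
        refine ⟨by simpa using g2, by simpa using g3, .inr ⟨by simp [IExp.eval], i + 1, ?_, hB, ?_⟩⟩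
        · simp [IExp.eval, g8]
        · simp [RExp.eval, IExp.eval, g4])
  have e : borderCode.run s = (Code.rep 11 0 borderStep).run s₁ := by
    simp [borderCode, Code.run, RExp.eval, IExp.eval, hs₁]
  rw [show s₁.ireg 0 = c by simpa [hs₁]] at h
  rw [e]
  exact h.2.2

/-- Writes the normal vector of the hyperplane that belongs to Border's condition for the violating
initial segment. -/
def normalCode : Code :=
  .rep 11 0 (.cond (.ilt (.reg 11) (.reg 7))
    (.rput 2 (.get 3 (.reg 11)) (.mul (.ofInt (.reg 1)) (.get 0 (.get 3 (.reg 11)))))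
    (.rput 2 (.get 3 (.reg 11)) (.ofInt (.lit 0))))

theorem run_normalCode (hc : s.ireg 0 = c) (hm : s.ireg 1 = m)
    (hdist : ∀ A : Fin c, s.rarr 0 A = μ A) (hσ : ∀ x : Fin c, s.iarr 3 x = σ x)
    (hbij : Function.Bijective σ) (A : Fin c) :
    (normalCode.run s).rarr 2 A = if A ∈ firstTypes σ (s.ireg 7) then m * μ A else 0 := by
  have h := rep_induction 11 0 (.cond (.ilt (.reg 11) (.reg 7))
    (.rput 2 (.get 3 (.reg 11)) (.mul (.ofInt (.reg 1)) (.get 0 (.get 3 (.reg 11)))))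
    (.rput 2 (.get 3 (.reg 11)) (.ofInt (.lit 0)))) s
    (fun i s' => ∀ x : Fin c, x < i →
      s'.rarr 2 (σ x) = if x < s.ireg 7 then m * μ (σ x) else 0) (by simp) (by
      rintro i hi s' hi' hF h x hx
      rw [hc] at hi
      have e1 : s'.ireg 1 = m := by rw [hF.ireg 1 rfl, hm]
      have e7 := hF.ireg 7 rfl
      have e2 : s'.rarr 0 (σ ⟨i, hi⟩) = μ (σ ⟨i, hi⟩) := by rw [hF.rarr 0 rfl, hdist]
      have e4 : s'.iarr 3 i = σ ⟨i, hi⟩ := by rw [hF.iarr 3 rfl, ← hσ]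
      rcases Nat.lt_succ_iff_lt_or_eq.1 hx with hx | hx
      · have hne : (σ x : ℕ) ≠ σ ⟨i, hi⟩ := fun he =>
          hx.ne (Fin.ext_iff.1 (hbij.1 (Fin.ext he)))
        simp [Code.run, RExp.eval, IExp.eval, hi', e4, hne, h x hx]
      · obtain rfl : x = ⟨i, hi⟩ := Fin.ext hx
        simp [Code.run, RExp.eval, IExp.eval, hi', e4, e1, e2, e7])
  rw [hc] at h
  obtain ⟨x, rfl⟩ := hbij.2 A
  have hmem : σ x ∈ firstTypes σ (s.ireg 7) ↔ (x : ℕ) < s.ireg 7 := by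
    simp [firstTypes, mem_below, hbij.1.eq_iff]
  simp only [hmem]
  exact h x x.2

/-- Decides feasibility, given the number of merge passes in integer register `5`. -/
def decideCode : Code := sortCode ;; borderCode ;; normalCode

/-- A rearrangement of `0, …, c - 1` is a permutation. -/
theorem exists_bijective_of_sum_eq {a : ℕ → ℕ}
    (h : ∀ f : ℕ → ℝ, ∑ x ∈ range c, f (a x) = ∑ x ∈ range c, f x) :
    ∃ σ : Fin c → Fin c, Function.Bijective σ ∧ ∀ x : Fin c, a x = σ x := by
  have hlt : ∀ x : Fin c, a x < c := by
    have h1 := h fun n => if n < c then 0 else 1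
    rw [sum_congr rfl (g := fun _ => (0 : ℝ)) fun x hx => if_pos (mem_range.1 hx), sum_const_zero,
      sum_eq_zero_iff_of_nonneg fun x _ => by split_ifs <;> norm_num] at h1
    intro x
    have := h1 x (mem_range.2 x.2)
    by_contra hcon
    simp [hcon] at this
  refine ⟨fun x => ⟨a x, hlt x⟩, Finite.injective_iff_bijective.1 ?_, fun x => rfl⟩
  intro x y hxy
  have hxy : a x = a y := Fin.ext_iff.1 hxy
  by_contra hne
  have h1 := h fun n => if n = a x then 1 else 0
  rw [sum_ite_eq', if_pos (mem_range.2 (hlt x))] at h1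
  have h2 : ∑ z ∈ ({(x : ℕ), (y : ℕ)} : Finset ℕ), (if a z = a x then (1 : ℝ) else 0) ≤
      ∑ z ∈ range c, if a z = a x then 1 else 0 :=
    sum_le_sum_of_subset_of_nonneg (by
      intro z hz
      simp only [mem_insert, mem_singleton] at hz
      rcases hz with rfl | rfl
      exacts [mem_range.2 x.2, mem_range.2 y.2]) fun z _ _ => by split_ifs <;> norm_num
  rw [sum_pair (fun he => hne (Fin.ext he)), h1, if_pos rfl, if_pos hxy.symm] at h2
  norm_num at h2

/-- Sufficiency of Border's condition: run on a memory that holds `μ` and `π`, the greedy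
decomposition finds a mechanism. -/
theorem feasible_of_implementable (hm : 1 ≤ m) (hμ : IsDistribution μ) (hπ : IsReducedForm π)
    (hI : Implementable m μ 1 π) : π ∈ feasibleForms m μ := by
  obtain ⟨p, K, d, h⟩ := exists_decompose_program
  let s : Store :=
    { ireg := fun x => if x = 0 then c else m
      rreg := fun _ => 0
      iarr := fun _ _ => 0
      rarr := fun a A => if hA : A < c then if a = 0 then μ ⟨A, hA⟩ else π ⟨A, hA⟩ else 0 }
  obtain ⟨-, -, D, -, -, -, hD⟩ := h m c μ π hm hμ hI s
    ⟨by simp [s], by simp [s], fun A => by simp [s], fun A => by simp [s]⟩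
  exact ⟨hπ, D.mechanism m, fun i A => (hD i A).ge⟩

theorem implementable_of_feasible (hμ : IsDistribution μ) (h : π ∈ feasibleForms m μ) :
    Implementable m μ 1 π :=
  implementable_one h.1 fun S _ => border_of_feasible hμ h S

theorem run_decideCode (hm : 1 ≤ m) (hμ : IsDistribution μ) (hπ : IsReducedForm π)
    (hs : HoldsInstance s m μ π) (hL : c ≤ 2 ^ s.ireg 5) :
    ((decideCode.run s).ireg 2 = 1 ∧ π ∈ feasibleForms m μ) ∨
    ((decideCode.run s).ireg 2 = 0 ∧ π ∉ feasibleForms m μ ∧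
      Separates (fun A : Fin c => (decideCode.run s).rarr 2 A) ((decideCode.run s).rreg 0) π
        (feasibleForms m μ)) := by
  obtain ⟨hc, hm', hdist, hform⟩ := hs
  obtain ⟨hsort, hperm⟩ := run_sortCode (s := s) (by rwa [hc])
  rw [hc] at hsort hperm
  obtain ⟨σ, hbij, hσ⟩ := exists_bijective_of_sum_eq hperm
  have hF₁ := frame_run sortCode s
  simp only [decideCode, Code.run]
  set s₁ := sortCode.run s
  have h := run_borderCode (s := s₁) (by rw [hF₁.ireg 0 rfl, hc]) (by rw [hF₁.ireg 1 rfl, hm'])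
    (by rw [hF₁.rarr 0 rfl]; exact hdist) (by rw [hF₁.rarr 1 rfl]; exact hform) hσ hbij.1
  have hF₂ := frame_run borderCode s₁
  set s₂ := borderCode.run s₁
  have hw := run_normalCode (s := s₂) (by rw [hF₂.ireg 0 rfl, hF₁.ireg 0 rfl, hc])
    (by rw [hF₂.ireg 1 rfl, hF₁.ireg 1 rfl, hm'])
    (by rw [hF₂.rarr 0 rfl, hF₁.rarr 0 rfl]; exact hdist) (by rw [hF₂.iarr 3 rfl]; exact hσ) hbij
  have hF₃ := frame_run normalCode s₂
  set s₃ := normalCode.run s₂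
  rw [hF₃.ireg 2 rfl, hF₃.rreg 0 rfl]
  rcases h with ⟨h2, hB⟩ | ⟨h2, n, h7, hB, h0⟩
  · refine .inl ⟨h2, feasible_of_implementable hm hμ hπ
      (implementable_of_border hm hμ hπ hbij.2 (fun x y hxy => ?_) hB)⟩
    have := hsort x y (Nat.zero_le _) hxy y.2
    rwa [hσ, hσ, hform, hform] at this
  · rw [h7] at hw
    have hsum : ∀ ρ : Fin c → ℝ, ∑ A : Fin c, s₃.rarr 2 A * ρ A =
        m * ∑ A ∈ firstTypes σ n, μ A * ρ A := by
      intro ρ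
      simp only [hw, ite_mul, zero_mul, sum_ite_mem, univ_inter, mul_sum, mul_assoc]
    refine .inr ⟨h2, fun hf => hB (border_of_feasible hμ hf _), ?_, fun ρ hρ => ?_⟩
    · rw [hsum, h0]; exact not_le.1 hB
    · rw [hsum, h0]; exact border_of_feasible hμ hρ _

theorem bounds_decideCode {y : ℕ} (hy : decideCode.bounds y) : y = 0 ∨ y = 1 ∨ y = 5 := by
  simp [decideCode, sortCode, passCode, nextBlockCode, moveCode, borderCode, borderStep,
    segmentCode, powCode, normalCode, bounds] at hy
  tauto

theorem time_decideCode {env : ℕ → ℕ} (hc : 1 ≤ env 0) (hm : 1 ≤ env 1) :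
    decideCode.time env ≤ decideCode.weight * (env 0 * (env 5 + env 1)) := by
  have hlin : ∀ p : Code, p.depth ≤ 1 → (∀ y, p.bounds y → y = 0) →
      p.time env ≤ p.weight * env 0 := fun p hp hb =>
    (time_le hc p fun y hy => by rw [hb y hy]).trans (Nat.mul_le_mul_left _
      ((Nat.pow_le_pow_right hc hp).trans_eq (pow_one _)))
  have h1 := hlin passCode le_rfl fun y hy => by
    simpa [passCode, nextBlockCode, moveCode, bounds] using hy
  have h2 := hlin (.rep 11 0 (.iput 3 (.reg 11) (.reg 11))) le_rfl fun y hy => by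
    simpa [bounds] using hy
  have h3 := hlin normalCode le_rfl fun y hy => by simpa [normalCode, bounds] using hy
  have h4 : borderStep.time env ≤ borderStep.weight * env 1 := by
    refine (time_le hm borderStep fun y hy => ?_).trans_eq
      (by rw [show borderStep.depth = 1 from rfl, pow_one])
    rw [show y = 1 by simpa [borderStep, segmentCode, powCode, bounds] using hy]
  have h5 : env 5 * (passCode.time env + 9) ≤ (passCode.weight + 9) * (env 0 * env 5) := by
    nlinarith [Nat.mul_le_mul_left (env 5) h1, Nat.mul_le_mul_left (env 5) hc]
  have h6 : env 0 * (borderStep.time env + 9) ≤ (borderStep.weight + 9) * (env 0 * env 1) := by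
    nlinarith [Nat.mul_le_mul_left (env 0) h4, Nat.mul_le_mul_left (env 0) hm]
  have h7 : env 0 ≤ env 0 * (env 5 + env 1) := Nat.le_mul_of_pos_right _ (by omega)
  have h8 : 1 ≤ env 0 * (env 5 + env 1) := hc.trans h7
  have h9 : env 0 * env 5 ≤ env 0 * (env 5 + env 1) := Nat.mul_le_mul_left _ (by omega)
  have h10 : env 0 * env 1 ≤ env 0 * (env 5 + env 1) := Nat.mul_le_mul_left _ (by omega)
  set X := env 0 * (env 5 + env 1)
  replace h2 := h2.trans (Nat.mul_le_mul_left _ h7)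
  replace h3 := h3.trans (Nat.mul_le_mul_left _ h7)
  replace h5 := h5.trans (Nat.mul_le_mul_left _ h9)
  replace h6 := h6.trans (Nat.mul_le_mul_left _ h10)
  rw [decideCode, sortCode, borderCode]
  simp only [time, weight, IExp.cost, RExp.cost] at h2 h3 h5 h6 ⊢
  nlinarith

/-- The number of merge passes is found by doubling a number until it reaches `c`, in time `O(c)`;
sorting takes time `O(c log c)`, and the check of `c` segments time `O(c m)`, since the machine has
no operation for powers. -/
theorem exists_decide_program : ∃ (p : RealRAM.Program) (K : ℝ),
    ∀ (m c : ℕ) (μ π : Fin c → ℝ), 1 ≤ m → IsDistribution μ → IsReducedForm π →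
    ∀ s : RealRAM.Store, HoldsInstance s m μ π →
      DecidesOrSeparates p s (K * (c * (Real.log c + m))) m μ π := by
  refine ⟨.seq passesCode.toProgram decideCode.toProgram,
    passesCode.weight + 2 * decideCode.weight, ?_⟩
  intro m c μ π hm hμ hπ s hs
  have hc : 1 ≤ c := by
    rcases c.eq_zero_or_pos with rfl | hc
    · simpa using hμ.2
    · exact hc
  obtain ⟨hc', hm', hdist, hform⟩ := hs
  obtain ⟨hL, hL'⟩ := run_passesCode s (by rwa [hc'])
  obtain ⟨τ, hτ, hE⟩ := exec_toProgram passesCode rfl (fun y hy => by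
    rw [show y = 0 by simpa [passesCode, bounds] using hy]; rfl) s
  have hF := frame_run passesCode s
  obtain ⟨τ', hτ', hE'⟩ := exec_toProgram decideCode rfl (fun y hy => by
    rcases bounds_decideCode hy with rfl | rfl | rfl <;> rfl) (passesCode.run s)
  set s₁ := passesCode.run s
  have e0 : s₁.ireg 0 = c := by rw [hF.ireg 0 rfl, hc']
  have e1 : s₁.ireg 1 = m := by rw [hF.ireg 1 rfl, hm']
  rw [hc'] at hL hL'
  have hs₁ : HoldsInstance s₁ m μ π :=
    ⟨e0, e1, by rw [hF.rarr 0 rfl]; exact hdist, by rw [hF.rarr 1 rfl]; exact hform⟩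
  refine ⟨τ + τ', _, .seq hE hE', ?_, run_decideCode hm hμ hπ hs₁ hL⟩
  have t1 : τ ≤ passesCode.weight * c := by
    refine hτ.trans ((time_le (M := c) hc passesCode fun y hy => ?_).trans_eq
      (by rw [show passesCode.depth = 1 from rfl, pow_one]))
    rw [show y = 0 by simpa [passesCode, bounds] using hy, hc']
  have t2 := hτ'.trans (time_decideCode (by rwa [e0]) (by rwa [e1]))
  rw [e0, e1] at t2
  have hlog : (s₁.ireg 5 : ℝ) ≤ 1 + 2 * Real.log c := by
    have h1 : (2 : ℝ) ^ s₁.ireg 5 ≤ 2 * c := by exact_mod_cast hL'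
    have h2 := Real.log_le_log (by positivity) h1
    have hc0 : (0 : ℝ) < c := by exact_mod_cast hc
    rw [Real.log_pow, Real.log_mul two_ne_zero hc0.ne'] at h2
    have h3 := Real.log_two_gt_d9
    have h4 : 0 ≤ Real.log c := Real.log_natCast_nonneg c
    by_contra! h5
    nlinarith
  have hmR : (1 : ℝ) ≤ m := by exact_mod_cast hm
  have hl0 : 0 ≤ Real.log c := Real.log_natCast_nonneg c
  have t1' : (τ : ℝ) ≤ passesCode.weight * c := by exact_mod_cast t1
  have t2' : (τ' : ℝ) ≤ decideCode.weight * (c * (s₁.ireg 5 + m)) := by exact_mod_cast t2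
  calc ((τ + τ' : ℕ) : ℝ) = τ + τ' := by push_cast; rfl
    _ ≤ passesCode.weight * c + decideCode.weight * (c * (s₁.ireg 5 + m)) := add_le_add t1' t2'
    _ ≤ passesCode.weight * (c * (Real.log c + m)) +
        decideCode.weight * (c * (2 * (Real.log c + m))) := by
      gcongr
      · exact le_mul_of_one_le_right c.cast_nonneg (by linarith)
      · linarith
    _ = _ := by ring

end Decide

end Auction

theorem mainTheorem7 :
    -- deciding feasibility or finding a separating hyperplane
    (∃ (p : RealRAM.Program) (K : ℝ),
      ∀ (m c : ℕ) (μ π : Fin c → ℝ), 1 ≤ m → Auction.IsDistribution μ → Auction.IsReducedForm π →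
      ∀ s : RealRAM.Store, Auction.HoldsInstance s m μ π →
        Auction.DecidesOrSeparates p s (K * (c * (Real.log c + m))) m μ π) ∧
    -- computing the description of a mechanism implementing a feasible reduced form
    (∃ (p : RealRAM.Program) (K d : ℕ),
      ∀ (m c : ℕ) (μ π : Fin c → ℝ), 1 ≤ m → Auction.IsDistribution μ →
      π ∈ Auction.feasibleForms m μ →
      ∀ s : RealRAM.Store, Auction.HoldsInstance s m μ π →
        ∃ (τ : ℕ) (s' : RealRAM.Store) (D : Auction.Description c),
          RealRAM.Exec p s τ s' ∧ τ ≤ K * (c * m) ^ d ∧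
          Auction.HoldsDescription s' D ∧
          Auction.ExactlyImplements μ (D.mechanism m) π) ∧
    -- running the described mechanism: sampling the random subset of the bidders
    (∃ (p : RealRAM.Program) (K d : ℕ),
      ∀ (m c : ℕ) (D : Auction.Description c) (t : Fin m → Fin c), 1 ≤ m →
      ∃ W : ℝ → Finset (Fin m),
        (∀ S : Finset (Fin m),
          MeasureTheory.volume {u : ℝ | u ∈ Set.Icc (0 : ℝ) 1 ∧ W u = S} =
            ENNReal.ofReal (∑ k with Auction.winners (D.level k) t = S, D.prob k)) ∧
        ∀ u ∈ Set.Icc (0 : ℝ) 1, ∀ s : RealRAM.Store, Auction.HoldsAuction s D t u →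
          ∃ (τ : ℕ) (s' : RealRAM.Store),
            RealRAM.Exec p s τ s' ∧ τ ≤ K * (c * m) ^ d ∧ Auction.HoldsSubset s' (W u)) := by
  refine ⟨Auction.exists_decide_program, ?_, Auction.exists_sample_program⟩
  obtain ⟨p, K, d, h⟩ := Auction.exists_decompose_program
  exact ⟨p, K, d, fun m c μ π hm hμ hπ =>
    h m c μ π hm hμ (Auction.implementable_of_feasible hμ hπ)⟩
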